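/- Let $\Delta^*=\{\omega\in\mathbb C: 0<|\omega|<1\}$ and let $\mathrm d\sigma^2=\rho(\omega)|\mathrm d\omega|^2$ be a conformal metric on $\Delta^*$ (with $\rho>0$ of class $C^2$) of Gauss curvature $-\frac{\Delta\log\rho}{2\rho}=0$. Suppose that its area has polynomial growth near the origin: there are constants $0<R<1$, $M>0$ and $N\ge 0$ such that $$\mathrm{Area}\big(\{\omega: 1/r<|\omega|<R\}\big)\le M r^N\qquad\text{for all } r>1/R .$$ Then for some $0<\varepsilon\le 1$ there is a holomorphic coordinate (an injective holomorphic function) $z=z(\omega)$ on $U_\varepsilon=\{|\omega|<\varepsilon\}$ with $z(0)=0$ in which the metric, on $U_\varepsilon\setminus\{0\}$, has one of the following three forms: 1. $\mathrm d\sigma^2=(\beta+1)^2|z|^{2\beta}|\mathrm dz|^2$ with $\beta\in\mathbb R\setminus\{-1\}$; 2. $\mathrm d\sigma^2=c^2|z|^{-2}|\mathrm dz|^2$ with $c>0$; 3. $\mathrm d\sigma^2=\left|\frac{\nu}{z}-\frac{n}{z^{n+1}}\right|^2|\mathrm dz|^2$ with $\nu>0$ and an integer $n\ge 1$. The form and its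 constants ($\beta$, or $c$, or $\nu$ and $n$) are uniquely determined by the metric: they are the same for all such $\varepsilon$ and $z$. Furthermore, if $z$ is a coordinate on $U_\varepsilon$ as above in which the metric has the first form with $\beta\in((-\infty,-1)\setminus\mathbb Z)\cup(-1,\infty)$, then the coordinates on $U_\varepsilon$ as above in which the metric has the first form with this $\beta$ are exactly the functions $\lambda z$ with $\lambda\in\mathbb C$, $|\lambda|=1$. If $z$ is a coordinate on $U_\varepsilon$ as above in which the metric has the second form with constant $c>0$, then the coordinates on $U_\varepsilon$ as above in which it has the second form with this $c$ are exactly the functions $pz$ with $p\in\mathbb C\setminus\{0\}$. -/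

import Mathlib

open Set Metric MeasureTheory
open scoped Laplacian

noncomputable section

/-- The punctured unit disk `{ω ∈ ℂ | 0 < |ω| < 1}`. -/
def puncturedDisk : Set ℂ := {ω | 0 < ‖ω‖ ∧ ‖ω‖ < 1}

/-- A conformal metric `ρ(ω) |dω|²` on a set `U` of the complex plane (used for open `U`):
its density `ρ` is positive and twice continuously differentiable on `U`, which is the least
regularity for which the Gauss curvature is defined classically.
The values of `density` outside `U` play no role. -/
structure ConformalMetric (U : Set ℂ) where
  /-- The coefficient `ρ` of `|dω|²`. -/
  density : ℂ → ℝ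
  contDiffOn : ContDiffOn ℝ 2 density U
  pos : ∀ ω ∈ U, 0 < density ω

namespace ConformalMetric

variable {U : Set ℂ}

/-- The Gauss curvature `K = - Δ (log ρ) / (2 ρ)` of `ρ |dω|²`; equivalently `- e^(-2φ) Δ φ`
for `ρ = e^(2φ)`. -/
def gaussCurvature (g : ConformalMetric U) (ω : ℂ) : ℝ :=
  -(Laplacian.laplacian (fun w => Real.log (g.density w)) ω) / (2 * g.density ω)

/-- The area `∬_A ρ dx dy` of a subset `A` of `U`. -/
def area (g : ConformalMetric U) (A : Set ℂ) : ENNReal :=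
  ∫⁻ ω in A, ENNReal.ofReal (g.density ω)

end ConformalMetric

/-- The annulus with centre `0`, inner radius `a` and outer radius `b`. -/
def annulus (a b : ℝ) : Set ℂ := {ω | a < ‖ω‖ ∧ ‖ω‖ < b}

/-- Polynomial growth of the area near the origin: for some `0 < R < 1`, `M > 0`, `N ≥ 0`, the
area of `{1 / r < |ω| < R}` is at most `M r ^ N` for all `r > 1 / R`. -/
def HasPolynomialAreaGrowth (g : ConformalMetric puncturedDisk) : Prop :=
  ∃ R M N : ℝ, 0 < R ∧ R < 1 ∧ 0 < M ∧ 0 ≤ N ∧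
    ∀ r : ℝ, 1 / R < r → g.area (annulus (1 / r) R) ≤ ENNReal.ofReal (M * r ^ N)

/-- `z` is a holomorphic coordinate on `{|ω| < ε}` with `z(0) = 0`. -/
structure IsCentredCoordinate (ε : ℝ) (z : ℂ → ℂ) : Prop where
  differentiableOn : DifferentiableOn ℂ z (ball 0 ε)
  injOn : InjOn z (ball 0 ε)
  map_zero : z 0 = 0

/-- The three families of expressions for a metric, before the constraints on the constants. -/
inductive LocalForm where
  | power (β : ℝ)
  | cylinder (c : ℝ)
  | pole (ν : ℝ) (n : ℕ)

namespace LocalForm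

/-- The constraints on the constants. -/
def Admissible : LocalForm → Prop
  | power β => β ≠ -1
  | cylinder c => 0 < c
  | pole ν n => 0 < ν ∧ 1 ≤ n

/-- The coefficient of `|dz|²`. -/
def coeff : LocalForm → ℂ → ℝ
  | power β, z => (β + 1) ^ 2 * ‖z‖ ^ (2 * β)
  | cylinder c, z => c ^ 2 * ‖z‖ ^ (-2 : ℤ)
  | pole ν n, z => ‖(ν : ℂ) / z - (n : ℂ) / z ^ (n + 1)‖ ^ 2

end LocalForm

/-- `z` is a holomorphic coordinate on `{|ω| < ε}`, `0 < ε ≤ 1`, with `z(0) = 0`, in which the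
metric `g` is `F.coeff z |dz|²`; here `|dz|² = |z'(ω)|² |dω|²`, and the identity is one of metrics
on the punctured disk `{0 < |ω| < ε}`. -/
structure IsNormalCoordinate (g : ConformalMetric puncturedDisk) (F : LocalForm) (ε : ℝ)
    (z : ℂ → ℂ) : Prop where
  pos : 0 < ε
  le_one : ε ≤ 1
  isCentredCoordinate : IsCentredCoordinate ε z
  metric_eq : ∀ ω ∈ ball (0 : ℂ) ε, ω ≠ 0 →
    g.density ω = F.coeff (z ω) * ‖deriv z ω‖ ^ 2

end

/-! Flatness says that `log ρ` is harmonic. Pulled back by `exp (2πiw)` to the upper half-plane it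
is `Re Φ`, and `Φ (w + 1) - Φ w` is a constant `iκ`. Removing a linear term makes `exp (Φ / 2)`
periodic, so `ρ = |ω|^(κ/2π) |H|²` with `H` holomorphic on the punctured disc. The sub-mean value
property turns area growth into `ρ ≤ C |ω|^(-K)`, so `H` has no essential singularity, and `ρ =
|ω|^(2b) |G|²` with `G 0 ≠ 0` (`ConformalMetric.exists_density_eq`).

The metric is thus `|θ|²` for the possibly multivalued form `θ = ω^(α-1) G dω`, `α = b + 1`. A
primitive `ω^α A + r log ω` amounts to the Euler equation `α A + ω A' + r ω^n = G`; a logarithm is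
needed only in the resonant case `α = -n`. The model primitives are `z^(β+1)`, `c log z` and `ν log
z + z^(-n)`. Substituting `z = ω exp s`, removing the `log ω` term and dividing by `ω^α` gives
`LocalForm.potential`. After rotating `θ` so that `r ≥ 0`, existence means solving `potential s = A`
for `s`: by a logarithm, a division, or the implicit function theorem.

For uniqueness, the exponent of `|ω|` fixes `α`. Two one-forms of equal modulus differ by a
unimodular factor, and `ω^n` is not of the form `-n A + ω A'`, so `|r|` is determined. Coordinates
are compared through the homogeneous Euler equation. -/

noncomputable section

open Filter Topology

/-! ### Analytic germs, the Euler equation and its resonances. -/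

section Germs

/-- A nonvanishing analytic germ has an analytic logarithm. -/
theorem AnalyticAt.exists_cexp_eq {f : ℂ → ℂ} {c : ℂ} (hf : AnalyticAt ℂ f c) (h0 : f c ≠ 0) :
    ∃ L : ℂ → ℂ, AnalyticAt ℂ L c ∧ ∀ᶠ ω in 𝓝 c, Complex.exp (L ω) = f ω := by
  refine ⟨fun ω => Complex.log (f ω / f c) + Complex.log (f c), ?_, ?_⟩
  · refine AnalyticAt.add (AnalyticAt.clog (hf.div analyticAt_const h0) ?_) analyticAt_const
    simp [h0]
  · filter_upwards [hf.continuousAt.eventually_ne h0] with ω hω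
    rw [Complex.exp_add, Complex.exp_log (div_ne_zero hω h0), Complex.exp_log h0,
      div_mul_cancel₀ _ h0]

/-- Two analytic germs of the same modulus differ by a unimodular constant. -/
theorem AnalyticAt.exists_unimodular_mul_eq {f g : ℂ → ℂ} {c : ℂ} (hf : AnalyticAt ℂ f c)
    (hg : AnalyticAt ℂ g c) (h0 : g c ≠ 0) (h : ∀ᶠ ω in 𝓝[≠] c, ‖f ω‖ = ‖g ω‖) :
    ∃ l : ℂ, ‖l‖ = 1 ∧ ∀ᶠ ω in 𝓝 c, f ω = l * g ω := by
  have hq : AnalyticAt ℂ (fun ω => f ω / g ω) c := hf.div hg h0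
  have hne := hg.continuousAt.eventually_ne h0
  have h1 : ∀ᶠ ω in 𝓝[≠] c, ‖f ω / g ω‖ = 1 := by
    filter_upwards [h, hne.filter_mono nhdsWithin_le_nhds] with ω hω hn
    rw [norm_div, hω, div_self (norm_ne_zero_iff.mpr hn)]
  have hc : ‖f c / g c‖ = 1 := by
    have ht : Tendsto (fun ω => ‖f ω / g ω‖) (𝓝[≠] c) (𝓝 ‖f c / g c‖) :=
      hq.continuousAt.norm.tendsto.mono_left nhdsWithin_le_nhds
    exact tendsto_nhds_unique ht (tendsto_const_nhds.congr' (h1.mono fun ω hω => hω.symm))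
  have h2 : ∀ᶠ ω in 𝓝 c, ‖f ω / g ω‖ = 1 := by
    rw [eventually_nhdsWithin_iff] at h1
    filter_upwards [h1] with ω hω
    by_cases e : ω = c
    · rw [e, hc]
    · exact hω e
  -- A constant modulus is a local maximum, so the maximum principle makes the quotient constant.
  have h3 := Complex.eventually_eq_of_isLocalMax_norm (f := fun ω => f ω / g ω) (c := c)
    (hq.eventually_analyticAt.mono fun ω hω => hω.differentiableAt)
    (by
      filter_upwards [h2] with ω hω
      simp only [Function.comp_apply, hω, hc, le_refl])
  refine ⟨f c / g c, hc, ?_⟩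
  filter_upwards [h3, hne] with ω hω hn
  rw [← hω, div_mul_cancel₀ _ hn]

/-- The Euler equation `α A + ω A' = G` has an analytic solution at `0` when `1 ≤ α`. -/
theorem AnalyticAt.exists_euler_eq_of_one_le {G : ℂ → ℂ} (hG : AnalyticAt ℂ G 0) {α : ℝ}
    (hα : 1 ≤ α) :
    ∃ A : ℂ → ℂ, AnalyticAt ℂ A 0 ∧ ∀ᶠ ω in 𝓝 0, (α : ℂ) * A ω + ω * deriv A ω = G ω := by
  obtain ⟨r, hr, hball⟩ := Metric.eventually_nhds_iff_ball.mp hG.eventually_analyticAt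
  have hmem : ∀ ω ∈ ball (0 : ℂ) r, ∀ t ∈ Icc (0 : ℝ) 1, (t : ℂ) * ω ∈ ball (0 : ℂ) r := by
    intro ω hω t ht
    rw [mem_ball_zero_iff] at *
    rw [norm_mul, Complex.norm_real, Real.norm_of_nonneg ht.1]
    exact lt_of_le_of_lt (mul_le_of_le_one_left (norm_nonneg _) ht.2) hω
  have hpow : Continuous fun t : ℝ => ((t ^ (α - 1) : ℝ) : ℂ) :=
    Complex.continuous_ofReal.comp (Real.continuous_rpow_const (by linarith))
  have hcG : ∀ ω ∈ ball (0 : ℂ) r, ContinuousOn (fun t : ℝ => G (t * ω)) (Icc 0 1) := by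
    intro ω hω t ht
    exact (ContinuousAt.comp (f := fun t : ℝ => (t : ℂ) * ω) (hball _ (hmem ω hω t ht)).continuousAt
      (by fun_prop)).continuousWithinAt
  have hcG' : ∀ ω ∈ ball (0 : ℂ) r, ContinuousOn (fun t : ℝ => deriv G (t * ω)) (Icc 0 1) := by
    intro ω hω t ht
    exact (ContinuousAt.comp (f := fun t : ℝ => (t : ℂ) * ω)
      (hball _ (hmem ω hω t ht)).deriv.continuousAt (by fun_prop)).continuousWithinAt
  -- This is `ω^(-α) ∫₀^ω ζ^(α-1) G(ζ) dζ` after the substitution `ζ = tω`, which removes the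
  -- multivalued powers of `ω`.
  let A : ℂ → ℂ := fun ω => ∫ t in (0 : ℝ)..1, ((t ^ (α - 1) : ℝ) : ℂ) * G (t * ω)
  have hint : ∀ ω ∈ ball (0 : ℂ) r, IntervalIntegrable
      (fun t : ℝ => ((t ^ (α - 1) : ℝ) : ℂ) * G (t * ω)) volume 0 1 := fun ω hω =>
    ContinuousOn.intervalIntegrable
      (by rw [uIcc_of_le zero_le_one]; exact hpow.continuousOn.mul (hcG ω hω))
  have hint' : ∀ ω ∈ ball (0 : ℂ) r, IntervalIntegrable
      (fun t : ℝ => ((t ^ (α - 1) : ℝ) : ℂ) * (deriv G (t * ω) * t)) volume 0 1 := fun ω hω =>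
    ContinuousOn.intervalIntegrable
      (by
        rw [uIcc_of_le zero_le_one]
        exact hpow.continuousOn.mul ((hcG' ω hω).mul Complex.continuous_ofReal.continuousOn))
  have hA : ∀ ω ∈ ball (0 : ℂ) r, HasDerivAt A
      (∫ t in (0 : ℝ)..1, ((t ^ (α - 1) : ℝ) : ℂ) * (deriv G (t * ω) * t)) ω := by
    intro ω hω
    obtain ⟨p, hp1, hp2⟩ := exists_between (mem_ball_zero_iff.mp hω)
    have hsub : closedBall (0 : ℂ) p ⊆ ball 0 r := closedBall_subset_ball hp2
    obtain ⟨M, hM⟩ := (isCompact_closedBall (0 : ℂ) p).exists_bound_of_continuousOn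
      (f := deriv G) fun x hx => (hball x (hsub hx)).deriv.continuousAt.continuousWithinAt
    refine (intervalIntegral.hasDerivAt_integral_of_dominated_loc_of_deriv_le
      (F := fun ω (t : ℝ) => ((t ^ (α - 1) : ℝ) : ℂ) * G (t * ω))
      (F' := fun ω (t : ℝ) => ((t ^ (α - 1) : ℝ) : ℂ) * (deriv G (t * ω) * t))
      (s := ball 0 p) (bound := fun _ => M)
      (isOpen_ball.mem_nhds (mem_ball_zero_iff.mpr hp1)) ?_ (hint ω hω)
      (hint' ω hω).def'.aestronglyMeasurable ?_ intervalIntegrable_const ?_).2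
    · filter_upwards [isOpen_ball.mem_nhds hω] with x hx
      exact (hint x hx).def'.aestronglyMeasurable
    · refine Eventually.of_forall fun t ht x hx => ?_
      rw [uIoc_of_le zero_le_one] at ht
      have ht' : t ∈ Icc (0 : ℝ) 1 := ⟨ht.1.le, ht.2⟩
      have hx' : (t : ℂ) * x ∈ closedBall (0 : ℂ) p := by
        rw [mem_closedBall_zero_iff, norm_mul, Complex.norm_real, Real.norm_of_nonneg ht'.1]
        exact (mul_le_of_le_one_left (norm_nonneg _) ht'.2).trans (mem_ball_zero_iff.mp hx).le
      have h1 : t ^ (α - 1) ≤ 1 := Real.rpow_le_one ht'.1 ht'.2 (by linarith)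
      have h0 : 0 ≤ t ^ (α - 1) := Real.rpow_nonneg ht'.1 _
      rw [norm_mul, norm_mul, Complex.norm_real, Complex.norm_real, Real.norm_of_nonneg h0,
        Real.norm_of_nonneg ht'.1]
      have hM' := hM _ hx'
      calc t ^ (α - 1) * (‖deriv G (t * x)‖ * t) ≤ 1 * (‖deriv G (t * x)‖ * 1) := by
            gcongr
            · exact mul_nonneg (norm_nonneg _) ht'.1
            · exact ht'.2
        _ ≤ M := by simpa using hM'
    · refine Eventually.of_forall fun t ht x hx => ?_
      rw [uIoc_of_le zero_le_one] at ht
      have hx' : (t : ℂ) * x ∈ ball (0 : ℂ) r :=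
        hmem x (ball_subset_ball hp2.le hx) t ⟨ht.1.le, ht.2⟩
      have hd : HasDerivAt (fun x : ℂ => (t : ℂ) * x) t x := by
        simpa using (hasDerivAt_id x).const_mul (t : ℂ)
      exact ((hball _ hx').differentiableAt.hasDerivAt.comp x hd).const_mul _
  refine ⟨A, ?_, ?_⟩
  · exact DifferentiableOn.analyticAt (s := ball 0 r)
      (fun x hx => (hA x hx).differentiableAt.differentiableWithinAt) (ball_mem_nhds _ hr)
  · filter_upwards [ball_mem_nhds (0 : ℂ) hr] with ω hω
    rw [(hA ω hω).deriv]
    -- Both terms together are the integral of `d/dt (t^α G(tω))`; only the endpoint `t = 1`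
    -- contributes.
    have hFTC := intervalIntegral.integral_eq_sub_of_hasDerivAt
      (a := 0) (b := 1) (f := fun t : ℝ => ((t ^ α : ℝ) : ℂ) * G (t * ω))
      (f' := fun t : ℝ => (α : ℂ) * (((t ^ (α - 1) : ℝ) : ℂ) * G (t * ω)) +
        ω * (((t ^ (α - 1) : ℝ) : ℂ) * (deriv G (t * ω) * t))) ?_
      (((hint ω hω).const_mul _).add ((hint' ω hω).const_mul _))
    · rw [intervalIntegral.integral_add ((hint ω hω).const_mul _) ((hint' ω hω).const_mul _),
        intervalIntegral.integral_const_mul, intervalIntegral.integral_const_mul] at hFTC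
      rw [show A ω = ∫ t in (0 : ℝ)..1, ((t ^ (α - 1) : ℝ) : ℂ) * G (t * ω) from rfl, hFTC]
      simp [Real.zero_rpow (by linarith : α ≠ 0)]
    · intro t ht
      rw [uIcc_of_le zero_le_one] at ht
      have hd : HasDerivAt (fun t : ℝ => (t : ℂ) * ω) ω t := by
        simpa using (Complex.ofRealCLM.hasDerivAt (x := t)).mul_const ω
      have h1 : HasDerivAt (fun t : ℝ => G (t * ω)) (deriv G (t * ω) * ω) t :=
        (hball _ (hmem ω hω t ht)).differentiableAt.hasDerivAt.comp t hd
      have h2 := (Real.hasDerivAt_rpow_const (x := t) (p := α) (Or.inr hα)).ofReal_comp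
      have h3 : t ^ α = t ^ (α - 1) * t := by
        rcases ht.1.eq_or_lt with h | h
        · rw [← h, mul_zero, Real.zero_rpow (by linarith)]
        · rw [Real.rpow_sub_one h.ne', div_mul_cancel₀ _ h.ne']
      refine (h2.fun_mul h1).congr_deriv ?_
      rw [h3]
      push_cast
      ring

/-- Every analytic germ `G` is `α A + ω A' + r ω ^ n`, where `r` vanishes unless `α = -n`. -/
theorem AnalyticAt.exists_euler_add_monomial_eq (m : ℕ) :
    ∀ {G : ℂ → ℂ} {α : ℝ}, AnalyticAt ℂ G 0 → 1 ≤ α + m →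
      ∃ (A : ℂ → ℂ) (r : ℂ) (n : ℕ), AnalyticAt ℂ A 0 ∧ (r ≠ 0 → α = -n) ∧
        ∀ᶠ ω in 𝓝 0, (α : ℂ) * A ω + ω * deriv A ω + r * ω ^ n = G ω := by
  induction m with
  | zero =>
    intro G α hG hα
    obtain ⟨A, hA, h⟩ := hG.exists_euler_eq_of_one_le (by simpa using hα)
    exact ⟨A, 0, 0, hA, by simp, by simpa using h⟩
  | succ m ih =>
    intro G α hG hα
    have hD : AnalyticAt ℂ (dslope G 0) 0 := by
      obtain ⟨p, hp⟩ := hG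
      exact ⟨_, hp.has_fpower_series_dslope_fslope⟩
    have hGD : ∀ ω, G ω = G 0 + ω * dslope G 0 ω := by
      intro ω
      have := sub_smul_dslope G 0 ω
      rw [sub_zero, smul_eq_mul] at this
      rw [this]; ring
    -- For `A = a + ωB` the left side is `α a + ω ((α + 1) B + ω B')`: dividing by `ω` raises `α` by
    -- one.
    obtain ⟨B, r, n, hB, hr, h⟩ := ih (α := α + 1) hD (by push_cast at hα; linarith)
    have hder : ∀ a : ℂ, ∀ᶠ ω in 𝓝 (0 : ℂ), HasDerivAt (fun ω => a + ω * B ω)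
        (B ω + ω * deriv B ω) ω := by
      intro a
      filter_upwards [hB.eventually_analyticAt] with ω hω
      simpa using ((hasDerivAt_id ω).mul hω.differentiableAt.hasDerivAt).const_add a
    have han : ∀ a : ℂ, AnalyticAt ℂ (fun ω => a + ω * B ω) 0 := fun a =>
      analyticAt_const.add (analyticAt_id.mul hB)
    -- At `α = 0` the constant term `G 0` cannot be absorbed into `A`: it is the resonant term, with
    -- exponent `0`.
    by_cases h0 : α = 0
    · have hr0 : r = 0 := by
        by_contra hne
        have := hr hne
        have : (0 : ℝ) ≤ n := n.cast_nonneg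
        linarith
      refine ⟨fun ω => 0 + ω * B ω, G 0, 0, han 0, fun _ => by simp [h0], ?_⟩
      filter_upwards [h, hder 0] with ω hω hd
      rw [hd.deriv, hGD ω, ← hω, h0, hr0]
      push_cast
      ring
    · refine ⟨fun ω => G 0 / α + ω * B ω, r, n + 1, han _, ?_, ?_⟩
      · intro hne
        have := hr hne
        push_cast
        linarith
      · filter_upwards [h, hder (G 0 / α)] with ω hω hd
        have : (α : ℂ) ≠ 0 := by exact_mod_cast h0
        rw [hd.deriv, hGD ω, ← hω]
        push_cast
        field_simp
        ring

/-- The monomial `ω ^ n` is not in the image of `A ↦ -n A + ω A'`. -/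
theorem AnalyticAt.eq_zero_of_euler_eq_monomial (n : ℕ) :
    ∀ {D : ℂ → ℂ} {c : ℂ}, AnalyticAt ℂ D 0 →
      (∀ᶠ ω in 𝓝 0, -(n : ℂ) * D ω + ω * deriv D ω = c * ω ^ n) → c = 0 := by
  induction n with
  | zero =>
    intro D c _ h
    simpa using h.self_of_nhds.symm
  | succ n ih =>
    intro D c hD h
    -- At `ω = 0` the equation reads `-(n + 1) D 0 = 0`; dividing `D` by `ω` then lowers `n` by one.
    have h0 : D 0 = 0 := by
      have := h.self_of_nhds
      simp only [zero_mul, add_zero, ne_eq, Nat.add_eq_zero_iff, one_ne_zero, and_false,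
        not_false_eq_true, zero_pow, mul_zero, mul_eq_zero, neg_eq_zero] at this
      exact this.resolve_left (by exact_mod_cast Nat.succ_ne_zero n)
    have hE : AnalyticAt ℂ (dslope D 0) 0 := by
      obtain ⟨p, hp⟩ := hD
      exact ⟨_, hp.has_fpower_series_dslope_fslope⟩
    have hDE : D = fun ω => ω * dslope D 0 ω := by
      funext ω
      have := sub_smul_dslope D 0 ω
      rw [sub_zero, smul_eq_mul, h0, sub_zero] at this
      exact this.symm
    refine ih hE ?_
    have hpunct : ∀ᶠ ω in 𝓝[≠] (0 : ℂ), -(n : ℂ) * dslope D 0 ω + ω * deriv (dslope D 0) ω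
        = c * ω ^ n := by
      filter_upwards [h.filter_mono nhdsWithin_le_nhds,
        hE.eventually_analyticAt.filter_mono nhdsWithin_le_nhds, self_mem_nhdsWithin]
        with ω hω ha hne
      have hd : HasDerivAt D (dslope D 0 ω + ω * deriv (dslope D 0) ω) ω := by
        conv => arg 1; rw [hDE]
        simpa using! (hasDerivAt_id ω).fun_mul ha.differentiableAt.hasDerivAt
      rw [hd.deriv] at hω
      have hDω : D ω = ω * dslope D 0 ω := congrFun hDE ω
      rw [hDω] at hω
      apply mul_left_cancel₀ hne
      push_cast at hω
      linear_combination hω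
    exact (((analyticAt_const.mul hE).add (analyticAt_id.mul hE.deriv)).frequently_eq_iff_eventually_eq
      (analyticAt_const.mul (analyticAt_id.pow n))).mp hpunct.frequently

/-- The homogeneous Euler equation has no nonzero analytic solution unless `-α` is a natural
number. -/
theorem AnalyticAt.eventually_eq_zero_of_euler_eq_zero {D : ℂ → ℂ} (hD : AnalyticAt ℂ D 0) {α : ℝ}
    (hα : ∀ n : ℕ, α ≠ -n) (h : ∀ᶠ ω in 𝓝 0, (α : ℂ) * D ω + ω * deriv D ω = 0) :
    ∀ᶠ ω in 𝓝 0, D ω = 0 := by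
  by_contra hne
  -- For `D = ω^k E` the equation becomes `(α + k) E + ω E' = 0`, and its value at `0` forces `α =
  -- -k`.
  obtain ⟨k, E, hE, hE0, hDE⟩ := hD.exists_eventuallyEq_pow_smul_nonzero_iff.mpr hne
  simp only [sub_zero, smul_eq_mul] at hDE
  have hpunct : ∀ᶠ ω in 𝓝[≠] (0 : ℂ), ((α : ℂ) + k) * E ω + ω * deriv E ω = 0 := by
    filter_upwards [h.filter_mono nhdsWithin_le_nhds,
      hE.eventually_analyticAt.filter_mono nhdsWithin_le_nhds,
      hDE.eventually_nhds.filter_mono nhdsWithin_le_nhds, self_mem_nhdsWithin]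
      with ω hω ha he hn
    have hd : HasDerivAt D (k * ω ^ (k - 1) * E ω + ω ^ k * deriv E ω) ω :=
      ((hasDerivAt_pow k ω).mul ha.differentiableAt.hasDerivAt).congr_of_eventuallyEq he
    rw [hd.deriv, he.self_of_nhds] at hω
    have hk : (k : ℂ) * ω ^ (k - 1) * ω = k * ω ^ k := by
      rcases k with _ | k
      · simp
      · rw [Nat.add_sub_cancel, pow_succ]; ring
    apply mul_left_cancel₀ (pow_ne_zero k hn)
    linear_combination hω - E ω * hk
  have hev := (((analyticAt_const.mul hE).add
    (analyticAt_id.mul hE.deriv)).frequently_eq_iff_eventually_eq (analyticAt_const (v := (0 : ℂ)))).mp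
    hpunct.frequently
  have := hev.self_of_nhds
  simp only [Pi.add_apply, Pi.mul_apply, id, zero_mul, add_zero, mul_eq_zero, hE0, or_false] at this
  apply hα k
  have h2 : ((α + k : ℝ) : ℂ) = 0 := by push_cast; exact this
  have h3 : α + k = 0 := by exact_mod_cast h2
  linarith

/-- An injective analytic germ vanishing at `0` is `ω exp (s ω)` with `s` analytic. -/
theorem AnalyticAt.exists_eq_mul_cexp_of_injOn {z : ℂ → ℂ} (hz : AnalyticAt ℂ z 0) (h0 : z 0 = 0)
    {U : Set ℂ} (hU : U ∈ 𝓝 0) (hinj : InjOn z U) :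
    ∃ s : ℂ → ℂ, AnalyticAt ℂ s 0 ∧ ∀ᶠ ω in 𝓝 0, z ω = ω * Complex.exp (s ω) := by
  have hne : ¬ ∀ᶠ ω in 𝓝 0, z ω = 0 := by
    intro h
    obtain ⟨ω, ⟨h1, h2⟩, h3⟩ := (((h.and hU).filter_mono nhdsWithin_le_nhds).and
      (self_mem_nhdsWithin (s := {(0 : ℂ)}ᶜ))).exists
    exact h3 (hinj h2 (mem_of_mem_nhds hU) (h1.trans h0.symm))
  obtain ⟨k, g, hg, hg0, hk⟩ := hz.exists_eventuallyEq_pow_smul_nonzero_iff.mpr hne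
  simp only [sub_zero, smul_eq_mul] at hk
  obtain ⟨L, hL, hLg⟩ := hg.exists_cexp_eq hg0
  have hk0 : k ≠ 0 := by
    rintro rfl
    have := hk.self_of_nhds
    rw [h0, pow_zero, one_mul] at this
    exact hg0 this.symm
  have hkC : (k : ℂ) ≠ 0 := Nat.cast_ne_zero.mpr hk0
  -- A local biholomorphism with `z = φ^k`. If `k > 1`, two points whose `φ`-values differ by a
  -- `k`-th root of unity contradict injectivity.
  let φ : ℂ → ℂ := fun ω => ω * Complex.exp (L ω / k)
  have hφ : AnalyticAt ℂ φ 0 := analyticAt_id.mul (hL.div analyticAt_const hkC).cexp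
  have hφ' : deriv φ 0 ≠ 0 := by
    have h1 : AnalyticAt ℂ (fun ω => Complex.exp (L ω / k)) 0 := (hL.div analyticAt_const hkC).cexp
    have : HasDerivAt φ (Complex.exp (L 0 / k)) 0 := by
      simpa using! (hasDerivAt_id (0 : ℂ)).mul h1.differentiableAt.hasDerivAt
    rw [this.deriv]
    exact Complex.exp_ne_zero _
  have hmap : map φ (𝓝 0) = 𝓝 0 := by
    have := hφ.hasStrictDerivAt.map_nhds_eq hφ'
    simpa [φ] using this
  have hzφ : ∀ᶠ ω in 𝓝 0, z ω = φ ω ^ k := by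
    filter_upwards [hk, hLg] with ω h1 h2
    rw [h1, ← h2, mul_pow, ← Complex.exp_nat_mul, mul_div_cancel₀ _ hkC]
  have himg : φ '' (U ∩ {ω | z ω = φ ω ^ k}) ∈ 𝓝 0 := by
    rw [← hmap]
    exact image_mem_map (inter_mem hU hzφ)
  obtain ⟨δ, hδ, hball⟩ := Metric.mem_nhds_iff.mp himg
  let ζ : ℂ := Complex.exp (2 * Real.pi * Complex.I / k)
  have hζ := Complex.isPrimitiveRoot_exp k hk0
  have hδ1 : ((δ / 2 : ℝ) : ℂ) ∈ ball (0 : ℂ) δ := by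
    rw [mem_ball_zero_iff, Complex.norm_real, Real.norm_of_nonneg (by positivity)]
    linarith
  have hδ2 : ((δ / 2 : ℝ) : ℂ) * ζ ∈ ball (0 : ℂ) δ := by
    rw [mem_ball_zero_iff, norm_mul, hζ.norm'_eq_one hk0, mul_one]
    exact mem_ball_zero_iff.mp hδ1
  obtain ⟨a, ⟨haU, ha⟩, haφ⟩ := hball hδ1
  obtain ⟨b, ⟨hbU, hb⟩, hbφ⟩ := hball hδ2
  have hab : a = b := by
    apply hinj haU hbU
    rw [show z a = φ a ^ k from ha, show z b = φ b ^ k from hb, haφ, hbφ, mul_pow,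
      show ζ ^ k = 1 from hζ.pow_eq_one, mul_one]
  have hζ1 : ζ = 1 := by
    have h1 : ((δ / 2 : ℝ) : ℂ) ≠ 0 := by exact_mod_cast (by positivity : δ / 2 ≠ 0)
    apply mul_left_cancel₀ h1
    rw [← hbφ, ← hab, haφ, mul_one]
  have hk1 : k = 1 := by
    rw [show Complex.exp (2 * Real.pi * Complex.I / k) = 1 from hζ1] at hζ
    exact hζ.unique (IsPrimitiveRoot.one)
  refine ⟨L, hL, ?_⟩
  filter_upwards [hk, hLg] with ω h1 h2
  rw [h1, h2, hk1, pow_one]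

/-- Analytic solution `s` of `exp (-n s) + ν ω ^ n s = A`. -/
theorem AnalyticAt.exists_cexp_add_pow_mul_eq {A : ℂ → ℂ} (hA : AnalyticAt ℂ A 0) (hA0 : A 0 ≠ 0)
    (ν : ℂ) {n : ℕ} (hn : n ≠ 0) :
    ∃ s : ℂ → ℂ, AnalyticAt ℂ s 0 ∧
      ∀ᶠ ω in 𝓝 0, Complex.exp (-n * s ω) + ν * ω ^ n * s ω = A ω := by
  have hnC : (n : ℂ) ≠ 0 := Nat.cast_ne_zero.mpr hn
  let f : ℂ × ℂ → ℂ := fun p => Complex.exp (-n * p.2) + ν * p.1 ^ n * p.2 - A p.1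
  -- At `ω = 0` the equation is `exp (-n s) = A 0`, since `n ≠ 0`; the partial derivative in `s`
  -- there is `-n A 0`.
  let u : ℂ × ℂ := (0, -Complex.log (A 0) / n)
  have hfu : f u = 0 := by
    simp only [f, u]
    rw [zero_pow hn, show -(n : ℂ) * (-Complex.log (A 0) / n) = Complex.log (A 0) by field_simp,
      Complex.exp_log hA0]
    ring
  have hAu : AnalyticAt ℂ A u.1 := hA
  have hAf : AnalyticAt ℂ (fun p : ℂ × ℂ => A p.1) u := hAu.comp analyticAt_fst
  have hf : AnalyticAt ℂ f u := by
    refine AnalyticAt.sub (AnalyticAt.add ?_ ?_) hAf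
    · exact (analyticAt_const.mul analyticAt_snd).cexp
    · exact (analyticAt_const.mul (analyticAt_fst.pow n)).mul analyticAt_snd
  have hfc : ContDiffAt ℂ ⊤ f u := hf.contDiffAt
  have hlin : (fderiv ℂ f u ∘L .inr ℂ ℂ ℂ) = ContinuousLinearMap.toSpanSingleton ℂ
      (-(n : ℂ) * A 0) := by
    have h1 : HasFDerivAt (fun t : ℂ => f (0, t)) (fderiv ℂ f u ∘L .inr ℂ ℂ ℂ) u.2 :=
      hf.differentiableAt.hasFDerivAt.comp (f := fun t : ℂ => ((0 : ℂ), t)) u.2 (hasFDerivAt_prodMk_right 0 u.2)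
    have h2 : HasDerivAt (fun t : ℂ => f (0, t)) (-(n : ℂ) * A 0) u.2 := by
      have : HasDerivAt (fun t : ℂ => Complex.exp (-n * t) - A 0)
          (Complex.exp (-n * u.2) * -n) u.2 := by
        simpa using (((hasDerivAt_id u.2).const_mul (-(n : ℂ))).cexp).sub_const (A 0)
      have he : Complex.exp (-n * u.2) = A 0 := by
        simp only [u]
        rw [show -(n : ℂ) * (-Complex.log (A 0) / n) = Complex.log (A 0) by field_simp,
          Complex.exp_log hA0]
      rw [he] at this
      convert this using 1
      · funext t
        simp [f, hn]
      · ring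
    exact h1.unique h2.hasFDerivAt
  have hinv : (fderiv ℂ f u ∘L .inr ℂ ℂ ℂ).IsInvertible := by
    rw [hlin]
    have hne : -(n : ℂ) * A 0 ≠ 0 := mul_ne_zero (neg_ne_zero.mpr hnC) hA0
    refine ⟨ContinuousLinearEquiv.unitsEquivAut ℂ (Units.mk0 _ hne), ?_⟩
    ext
    simp
  refine ⟨hfc.implicitFunction (by simp) hinv, ?_, ?_⟩
  · exact (hfc.contDiffAt_implicitFunction (by simp) hinv).analyticAt
  · filter_upwards [hfc.eventually_apply_implicitFunction (by simp) hinv] with ω hω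
    rw [hfu] at hω
    exact sub_eq_zero.mp hω

end Germs

/-! ### Sub-mean value inequalities. -/

section Area

/-- The sub-mean value property over circles, for the modulus of a holomorphic function. -/
theorem DifferentiableOn.two_pi_mul_norm_le_lintegral {F : ℂ → ℂ} {c : ℂ} {d r : ℝ}
    (hF : DifferentiableOn ℂ F (ball c d)) (hr : r ∈ Ioo 0 d) :
    ENNReal.ofReal (2 * Real.pi * ‖F c‖) ≤
      ∫⁻ θ in Ioo (-Real.pi) Real.pi, ENNReal.ofReal ‖F (circleMap c r θ)‖ := by
  have hcl : closedBall c r ⊆ ball c d := closedBall_subset_ball hr.2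
  have havg : Real.circleAverage F c r = F c := by
    apply DiffContOnCl.circleAverage
    rw [abs_of_pos hr.1]
    exact hF.diffContOnCl_ball hcl
  have hcont : Continuous fun θ : ℝ => F (circleMap c r θ) :=
    hF.continuousOn.comp_continuous (continuous_circleMap c r)
      fun θ => hcl (circleMap_mem_closedBall c hr.1.le θ)
  have hper : Function.Periodic (fun θ : ℝ => F (circleMap c r θ)) (2 * Real.pi) :=
    fun θ => by simp [periodic_circleMap c r θ]
  have hint : ∫ θ in (-Real.pi)..Real.pi, F (circleMap c r θ) = (2 * Real.pi) • F c := by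
    have h1 := hper.intervalIntegral_add_eq (-Real.pi) 0
    rw [show -Real.pi + 2 * Real.pi = Real.pi by ring, zero_add] at h1
    rw [h1, ← havg, Real.circleAverage_def, smul_smul, mul_inv_cancel₀ (by positivity), one_smul]
  have hle : -Real.pi ≤ Real.pi := by linarith [Real.pi_pos]
  have hnorm := intervalIntegral.norm_integral_le_integral_norm (μ := volume)
    (f := fun θ : ℝ => F (circleMap c r θ)) hle
  rw [hint, norm_smul, Real.norm_of_nonneg (by positivity), intervalIntegral.integral_of_le hle,
    integral_Ioc_eq_integral_Ioo] at hnorm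
  rw [← ofReal_integral_eq_lintegral_ofReal]
  · exact ENNReal.ofReal_le_ofReal hnorm
  · exact (hcont.norm.integrableOn_Icc).mono_set Ioo_subset_Icc_self
  · exact Eventually.of_forall fun _ => norm_nonneg _

/-- The sub-mean value property over discs, for the modulus of a holomorphic function. -/
theorem DifferentiableOn.pi_mul_sq_mul_norm_le_lintegral {F : ℂ → ℂ} {c : ℂ} {d : ℝ} (hd : 0 < d)
    (hF : DifferentiableOn ℂ F (ball c d)) :
    ENNReal.ofReal (Real.pi * d ^ 2 * ‖F c‖) ≤ ∫⁻ ω in ball c d, ENNReal.ofReal ‖F ω‖ := by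
  -- Extension by zero, to apply the polar coordinate formula on the whole plane.
  let h : ℂ → ENNReal := (ball c d).indicator fun ω => ENNReal.ofReal ‖F ω‖
  let k : ℝ × ℝ → ENNReal := fun p =>
    ENNReal.ofReal p.1 * ENNReal.ofReal ‖F (circleMap c p.1 p.2)‖
  have hpolar : ∀ p : ℝ × ℝ, c + Complex.polarCoord.symm p = circleMap c p.1 p.2 := by
    intro p
    rw [Complex.polarCoord_symm_apply, circleMap, Complex.exp_mul_I]
    push_cast
    rfl
  have hmaps : ∀ p ∈ Ioo 0 d ×ˢ Ioo (-Real.pi) Real.pi, circleMap c p.1 p.2 ∈ ball c d := by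
    rintro p ⟨hp, -⟩
    exact closedBall_subset_ball hp.2 (circleMap_mem_closedBall c hp.1.le p.2)
  have hcm : Continuous fun p : ℝ × ℝ => circleMap c p.1 p.2 := by
    unfold circleMap
    fun_prop
  have hmeas : AEMeasurable k ((volume.restrict (Ioo 0 d)).prod
      (volume.restrict (Ioo (-Real.pi) Real.pi))) := by
    rw [Measure.prod_restrict]
    refine ContinuousOn.aemeasurable ?_ (measurableSet_Ioo.prod measurableSet_Ioo)
    have h1 : ContinuousOn (fun p : ℝ × ℝ => p.1 * ‖F (circleMap c p.1 p.2)‖)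
        (Ioo 0 d ×ˢ Ioo (-Real.pi) Real.pi) :=
      continuous_fst.continuousOn.mul (hF.continuousOn.comp hcm.continuousOn hmaps).norm
    refine (ENNReal.continuous_ofReal.comp_continuousOn h1).congr fun p hp => ?_
    simp only [k, Function.comp_apply]
    rw [ENNReal.ofReal_mul hp.1.1.le]
  have hI : ∫⁻ r in Ioo 0 d, ENNReal.ofReal (r * (2 * Real.pi * ‖F c‖))
      = ENNReal.ofReal (Real.pi * d ^ 2 * ‖F c‖) := by
    rw [← ofReal_integral_eq_lintegral_ofReal]
    · rw [← integral_Ioc_eq_integral_Ioo, ← intervalIntegral.integral_of_le hd.le,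
        intervalIntegral.integral_mul_const, integral_id]
      congr 1
      ring
    · exact (by fun_prop : Continuous fun r : ℝ => r * (2 * Real.pi * ‖F c‖)).integrableOn_Icc.mono_set
        Ioo_subset_Icc_self
    · filter_upwards [ae_restrict_mem measurableSet_Ioo] with r hr
      have := hr.1
      simp only [Pi.zero_apply]
      positivity
  calc ENNReal.ofReal (Real.pi * d ^ 2 * ‖F c‖)
      = ∫⁻ r in Ioo 0 d, ENNReal.ofReal (r * (2 * Real.pi * ‖F c‖)) := hI.symm
    _ ≤ ∫⁻ r in Ioo 0 d, ∫⁻ θ in Ioo (-Real.pi) Real.pi, k (r, θ) := by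
        refine setLIntegral_mono' measurableSet_Ioo fun r hr => ?_
        simp only [k]
        rw [lintegral_const_mul' _ _ ENNReal.ofReal_ne_top, ENNReal.ofReal_mul hr.1.le]
        gcongr
        exact hF.two_pi_mul_norm_le_lintegral hr
    _ = ∫⁻ p in Ioo 0 d ×ˢ Ioo (-Real.pi) Real.pi, k p := by
        rw [Measure.volume_eq_prod, ← Measure.prod_restrict, lintegral_prod _ hmeas]
    _ = ∫⁻ p in Ioo 0 d ×ˢ Ioo (-Real.pi) Real.pi,
          ENNReal.ofReal p.1 • h (c + Complex.polarCoord.symm p) := by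
        refine setLIntegral_congr_fun (measurableSet_Ioo.prod measurableSet_Ioo) fun p hp => ?_
        simp only [k, h]
        rw [hpolar, indicator_of_mem (hmaps p hp), smul_eq_mul]
    _ ≤ ∫⁻ p in polarCoord.target, ENNReal.ofReal p.1 • h (c + Complex.polarCoord.symm p) := by
        refine lintegral_mono_set ?_
        rw [polarCoord_target]
        exact prod_mono Ioo_subset_Ioi_self Subset.rfl
    _ = ∫⁻ ω, h (c + ω) := Complex.lintegral_comp_polarCoord_symm fun ω => h (c + ω)
    _ = ∫⁻ ω in ball c d, ENNReal.ofReal ‖F ω‖ := by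
        rw [lintegral_add_left_eq_self, lintegral_indicator measurableSet_ball]

end Area

/-! ### Harmonic functions on the punctured disc. -/

section Harmonic

open InnerProductSpace

/-- The precomposition of a harmonic function with an analytic function is harmonic. -/
theorem InnerProductSpace.HarmonicAt.comp_analyticAt {u : ℂ → ℝ} {φ : ℂ → ℂ} {x : ℂ}
    (hu : HarmonicAt u (φ x)) (hφ : AnalyticAt ℂ φ x) : HarmonicAt (u ∘ φ) x := by
  obtain ⟨r, hr, hball⟩ := Metric.eventually_nhds_iff_ball.mp hu.eventually
  obtain ⟨F, hF, hFu⟩ := HarmonicOnNhd.exists_analyticOnNhd_ball_re_eq (f := u) hball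
  have h1 : HarmonicAt (fun w => (F (φ w)).re) x :=
    ((hF _ (mem_ball_self hr)).comp hφ).harmonicAt_re
  refine (harmonicAt_congr_nhds ?_).mp h1
  filter_upwards [hφ.continuousAt.preimage_mem_nhds (ball_mem_nhds _ hr)] with w hw
  exact hFu hw

/-- The imaginary part is `(1 - |ζ|²) / |1 - ζ|²`. -/
theorem Complex.im_cayley_pos {ζ : ℂ} (hζ : ‖ζ‖ < 1) : 0 < (Complex.I * ((1 + ζ) / (1 - ζ))).im := by
  have hne : 1 - ζ ≠ 0 := by
    intro h
    rw [← sub_eq_zero.mp h, norm_one] at hζ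
    exact lt_irrefl _ hζ
  have hpos : 0 < Complex.normSq (1 - ζ) := Complex.normSq_pos.mpr hne
  have h2 : ζ.re * ζ.re + ζ.im * ζ.im < 1 := by
    rw [← Complex.normSq_apply, Complex.normSq_eq_norm_sq]
    nlinarith [norm_nonneg ζ]
  rw [Complex.I_mul_im, Complex.div_re, ← add_div]
  apply div_pos _ hpos
  simp only [Complex.add_re, Complex.one_re, Complex.sub_re, Complex.add_im, Complex.one_im,
    Complex.sub_im]
  nlinarith

/-- This follows from `|w + i|² - |w - i|² = 4 Im w`. -/
theorem Complex.norm_sub_I_div_add_I_lt_one {w : ℂ} (hw : 0 < w.im) :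
    ‖(w - Complex.I) / (w + Complex.I)‖ < 1 := by
  have hne : w + Complex.I ≠ 0 := by
    intro h
    have := congrArg Complex.im h
    simp at this
    linarith
  rw [norm_div, div_lt_one (norm_pos_iff.mpr hne)]
  refine lt_of_pow_lt_pow_left₀ 2 (norm_nonneg _) ?_
  rw [← Complex.normSq_eq_norm_sq, ← Complex.normSq_eq_norm_sq, Complex.normSq_apply,
    Complex.normSq_apply]
  simp only [Complex.sub_re, Complex.I_re, Complex.sub_im, Complex.I_im, Complex.add_re,
    Complex.add_im]
  nlinarith

/-- A harmonic function on the punctured disk, pulled back to the upper half-plane, is the real part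
of a holomorphic function. -/
theorem exists_re_eq_of_harmonic_puncturedDisk {u : ℂ → ℝ}
    (hu : ∀ ω ∈ puncturedDisk, HarmonicAt u ω) :
    ∃ Φ : ℂ → ℂ, DifferentiableOn ℂ Φ {w | 0 < w.im} ∧
      ∀ w : ℂ, 0 < w.im → (Φ w).re = u (Function.Periodic.qParam 1 w) := by
  -- The Cayley transform moves the problem to a disc, where a harmonic function is the real part of
  -- an analytic one.
  let C : ℂ → ℂ := fun ζ => Complex.I * ((1 + ζ) / (1 - ζ))
  have hsub : ∀ ζ ∈ ball (0 : ℂ) 1, 1 - ζ ≠ 0 := by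
    intro ζ hζ h
    rw [← sub_eq_zero.mp h, mem_ball_zero_iff, norm_one] at hζ
    exact lt_irrefl _ hζ
  have hC : ∀ ζ ∈ ball (0 : ℂ) 1, AnalyticAt ℂ C ζ := fun ζ hζ =>
    analyticAt_const.mul ((analyticAt_const.add analyticAt_id).div
      (analyticAt_const.sub analyticAt_id) (hsub ζ hζ))
  have hq : ∀ w : ℂ, AnalyticAt ℂ (Function.Periodic.qParam 1) w := fun w =>
    Function.Periodic.differentiable_qParam.analyticAt w
  have hharm : HarmonicOnNhd (u ∘ fun ζ => Function.Periodic.qParam 1 (C ζ)) (ball 0 1) := by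
    intro ζ hζ
    refine HarmonicAt.comp_analyticAt (hu _ ⟨?_, ?_⟩) ((hq _).comp (hC ζ hζ))
    · exact norm_pos_iff.mpr (Function.Periodic.qParam_ne_zero _)
    · exact Function.Periodic.norm_qParam_lt_one one_pos
        (Complex.im_cayley_pos (mem_ball_zero_iff.mp hζ))
  obtain ⟨F, hF, hFu⟩ := hharm.exists_analyticOnNhd_ball_re_eq
  have hadd : ∀ w : ℂ, 0 < w.im → w + Complex.I ≠ 0 := by
    intro w hw h
    have := congrArg Complex.im h
    simp at this
    linarith
  have hmem : ∀ w : ℂ, 0 < w.im → (w - Complex.I) / (w + Complex.I) ∈ ball (0 : ℂ) 1 :=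
    fun w hw => mem_ball_zero_iff.mpr (Complex.norm_sub_I_div_add_I_lt_one hw)
  refine ⟨fun w => F ((w - Complex.I) / (w + Complex.I)), ?_, ?_⟩
  · intro w hw
    refine DifferentiableAt.differentiableWithinAt ?_
    refine DifferentiableAt.comp (g := F) w (hF _ (hmem w hw)).differentiableAt ?_
    exact (differentiableAt_id.sub_const _).div (differentiableAt_id.add_const _) (hadd w hw)
  · intro w hw
    have h1 := hFu (hmem w hw)
    simp only [Function.comp_apply] at h1
    rw [h1]
    congr 2
    have h2 := hadd w hw
    simp only [C]
    have h3 : 1 + (w - Complex.I) / (w + Complex.I) = 2 * w / (w + Complex.I) := by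
      field_simp; ring
    have h4 : 1 - (w - Complex.I) / (w + Complex.I) = 2 * Complex.I / (w + Complex.I) := by
      field_simp; ring
    rw [h3, h4]
    field_simp

end Harmonic

/-! ### The density of a flat metric near the puncture. -/

theorem isOpen_puncturedDisk : IsOpen puncturedDisk :=
  (isOpen_lt continuous_const continuous_norm).inter (isOpen_lt continuous_norm continuous_const)

theorem ConformalMetric.harmonicAt_log_density {g : ConformalMetric puncturedDisk}
    (hflat : ∀ ω ∈ puncturedDisk, g.gaussCurvature ω = 0) {ω : ℂ} (hω : ω ∈ puncturedDisk) :
    InnerProductSpace.HarmonicAt (fun w => Real.log (g.density w)) ω := by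
  refine ⟨?_, ?_⟩
  · exact (g.contDiffOn.contDiffAt (isOpen_puncturedDisk.mem_nhds hω)).log (g.pos ω hω).ne'
  · filter_upwards [isOpen_puncturedDisk.mem_nhds hω] with x hx
    have h := hflat x hx
    have hp := g.pos x hx
    rw [ConformalMetric.gaussCurvature, div_eq_zero_iff, neg_eq_zero] at h
    exact h.resolve_right (by positivity)

/-- Polynomial growth of the area bounds the density of a flat metric by a power of `‖ω‖`. -/
theorem ConformalMetric.exists_density_mul_norm_pow_le {g : ConformalMetric puncturedDisk}
    (hflat : ∀ ω ∈ puncturedDisk, g.gaussCurvature ω = 0) (hgrowth : HasPolynomialAreaGrowth g) :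
    ∃ (K : ℕ) (C : ℝ), ∀ᶠ ω in 𝓝[≠] 0, g.density ω * ‖ω‖ ^ K ≤ C := by
  obtain ⟨R, M, N, hR, hR1, hM, hN, hA⟩ := hgrowth
  -- The disc of radius `|ω|/2` about `ω` lies in the annulus with `r = 4/|ω|`, so `π (|ω|/2)² ρ(ω)
  -- ≤ M (4/|ω|)^N`.
  refine ⟨⌈N⌉₊ + 2, M * 4 ^ ⌈N⌉₊ * 4 / Real.pi, ?_⟩
  filter_upwards [(ball_mem_nhds (0 : ℂ) (half_pos hR) |> fun h => mem_nhdsWithin_of_mem_nhds h),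
    self_mem_nhdsWithin] with ω hω hne
  rw [mem_ball_zero_iff] at hω
  have hpos : 0 < ‖ω‖ := norm_pos_iff.mpr hne
  have hsub : ball ω (‖ω‖ / 2) ⊆ annulus (1 / (4 / ‖ω‖)) R := by
    intro x hx
    rw [mem_ball, dist_eq_norm] at hx
    have h1 : ‖ω‖ ≤ ‖x‖ + ‖x - ω‖ := by
      rw [norm_sub_rev]
      simpa using norm_add_le x (ω - x)
    have h2 : ‖x‖ ≤ ‖ω‖ + ‖x - ω‖ := by simpa using norm_add_le ω (x - ω)
    refine ⟨?_, by linarith⟩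
    rw [one_div_div]
    linarith
  have hsub' : ball ω (‖ω‖ / 2) ⊆ puncturedDisk := by
    intro x hx
    have h := hsub hx
    exact ⟨lt_trans (by positivity) h.1, h.2.trans hR1⟩
  obtain ⟨F, hF, hFu⟩ :=
    InnerProductSpace.HarmonicOnNhd.exists_analyticOnNhd_ball_re_eq
      (f := fun w => Real.log (g.density w)) (z := ω) (R := ‖ω‖ / 2)
      fun x hx => g.harmonicAt_log_density hflat (hsub' hx)
  have hdens : ∀ x ∈ ball ω (‖ω‖ / 2), ‖Complex.exp (F x)‖ = g.density x := by
    intro x hx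
    have h1 : (F x).re = Real.log (g.density x) := hFu hx
    rw [Complex.norm_exp, h1, Real.exp_log (g.pos x (hsub' hx))]
  have hmean := DifferentiableOn.pi_mul_sq_mul_norm_le_lintegral (half_pos hpos)
    (fun x hx => (hF x hx).differentiableAt.cexp.differentiableWithinAt)
  rw [hdens ω (mem_ball_self (half_pos hpos)),
    setLIntegral_congr_fun (g := fun x => ENNReal.ofReal (g.density x)) measurableSet_ball
      (fun x hx => by rw [hdens x hx])] at hmean
  have hr : 1 / R < 4 / ‖ω‖ := by
    rw [div_lt_div_iff₀ hR hpos]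
    linarith
  have h1 := (hmean.trans (lintegral_mono_set hsub)).trans (hA _ hr)
  have h4 : 1 ≤ 4 / ‖ω‖ := by
    rw [le_div_iff₀ hpos]
    linarith
  rw [ENNReal.ofReal_le_ofReal_iff (by positivity)] at h1
  have h2 : (4 / ‖ω‖) ^ N ≤ (4 / ‖ω‖) ^ ⌈N⌉₊ := by
    rw [← Real.rpow_natCast]
    exact Real.rpow_le_rpow_of_exponent_le h4 (Nat.le_ceil N)
  have h3 := h1.trans (mul_le_mul_of_nonneg_left h2 hM.le)
  rw [div_pow 4, ← mul_div_assoc M, le_div_iff₀ (by positivity)] at h3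
  rw [le_div_iff₀ Real.pi_pos, pow_add]
  nlinarith

/-- Near the puncture, the density of a flat metric of polynomial area growth is
`‖ω‖ ^ (2 b) * ‖G ω‖ ^ 2` with `G` analytic and nonvanishing. -/
theorem ConformalMetric.exists_density_eq {g : ConformalMetric puncturedDisk}
    (hflat : ∀ ω ∈ puncturedDisk, g.gaussCurvature ω = 0) (hgrowth : HasPolynomialAreaGrowth g) :
    ∃ (b : ℝ) (G : ℂ → ℂ), AnalyticAt ℂ G 0 ∧ G 0 ≠ 0 ∧
      ∀ᶠ ω in 𝓝[≠] 0, g.density ω = ‖ω‖ ^ (2 * b) * ‖G ω‖ ^ 2 := by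
  obtain ⟨K, C, hKC⟩ := g.exists_density_mul_norm_pow_le hflat hgrowth
  obtain ⟨Φ, hΦ, hΦu⟩ := exists_re_eq_of_harmonic_puncturedDisk
    (u := fun w => Real.log (g.density w)) fun ω hω => g.harmonicAt_log_density hflat hω
  have hopen : IsOpen {w : ℂ | 0 < w.im} := isOpen_lt continuous_const Complex.continuous_im
  have hconn : IsConnected {w : ℂ | 0 < w.im} :=
    ⟨⟨Complex.I, by simp⟩, (convex_halfSpace_im_gt 0).isPreconnected⟩
  have him1 : ∀ w : ℂ, (w + 1).im = w.im := fun w => by simp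
  have hq1 : ∀ w : ℂ, Function.Periodic.qParam 1 (w + 1) = Function.Periodic.qParam 1 w := by
    intro w
    simp only [Function.Periodic.qParam]
    rw [show (2 * Real.pi * Complex.I * (w + 1) / ((1 : ℝ) : ℂ)) =
      2 * Real.pi * Complex.I * w / ((1 : ℝ) : ℂ) + 2 * Real.pi * Complex.I by push_cast; ring,
      Complex.exp_periodic]
  -- The real part of `Φ (w + 1) - Φ w` vanishes, so the difference is the constant `iκ`.
  obtain ⟨κ, hκ⟩ := AnalyticOnNhd.eq_re_add_const_mul_I_of_re_eq_const (c₀ := 0)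
    (f := fun w => Φ (w + 1) - Φ w) (U := {w : ℂ | 0 < w.im}) (by
      refine DifferentiableOn.analyticOnNhd (fun w hw => ?_) hopen
      have h1 : DifferentiableAt ℂ Φ (w + 1) :=
        hΦ.differentiableAt (hopen.mem_nhds (by simpa using hw))
      have h2 : DifferentiableAt ℂ Φ w := hΦ.differentiableAt (hopen.mem_nhds hw)
      exact ((h1.comp w (differentiableAt_id.add_const 1)).sub h2).differentiableWithinAt)
    (by
      intro w hw
      have hw' : 0 < w.im := hw
      simp only [Complex.sub_re]
      rw [hΦu w hw', hΦu (w + 1) (by rwa [him1]), hq1, sub_self])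
    hopen hconn
  classical
  -- The linear term cancels the period `iκ/2` of `Φ/2`. The value `0` off the half-plane makes `E`
  -- periodic on all of `ℂ`, as `cuspFunction` needs.
  let E : ℂ → ℂ := fun w =>
    if 0 < w.im then Complex.exp (Φ w / 2 - Complex.I * κ * w / 2) else 0
  have hEper : Function.Periodic E ((1 : ℝ) : ℂ) := by
    intro w
    simp only [E, Complex.ofReal_one, him1]
    split_ifs with hw
    · have h := hκ w hw
      rw [sub_eq_iff_eq_add] at h
      rw [h]
      congr 1
      push_cast
      ring
    · rfl
  have hEd : ∀ w : ℂ, 0 < w.im → DifferentiableAt ℂ E w := by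
    intro w hw
    have h2 : DifferentiableAt ℂ Φ w := hΦ.differentiableAt (hopen.mem_nhds hw)
    have : DifferentiableAt ℂ (fun w => Complex.exp (Φ w / 2 - Complex.I * κ * w / 2)) w := by
      fun_prop
    refine this.congr_of_eventuallyEq ?_
    filter_upwards [hopen.mem_nhds hw] with x hx
    exact if_pos hx
  let H : ℂ → ℂ := Function.Periodic.cuspFunction 1 E
  have hpt : ∀ ω ∈ puncturedDisk, DifferentiableAt ℂ H ω ∧
      g.density ω = ‖ω‖ ^ (κ / (2 * Real.pi)) * ‖H ω‖ ^ 2 := by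
    intro ω hω
    have hne : ω ≠ 0 := norm_pos_iff.mp hω.1
    set w := Function.Periodic.invQParam 1 ω with hwdef
    have hwω : Function.Periodic.qParam 1 w = ω :=
      Function.Periodic.qParam_right_inv one_ne_zero hne
    have hwim : w.im = -1 / (2 * Real.pi) * Real.log ‖ω‖ := Function.Periodic.im_invQParam 1 ω
    have hlog : Real.log ‖ω‖ < 0 := Real.log_neg hω.1 hω.2
    have hwpos : 0 < w.im := by
      rw [hwim]
      exact mul_pos_of_neg_of_neg (div_neg_of_neg_of_pos (by norm_num) (by positivity)) hlog
    have hHω : H ω = E w := by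
      rw [← hwω]
      exact Function.Periodic.eq_cuspFunction one_ne_zero hEper w
    refine ⟨?_, ?_⟩
    · rw [← hwω]
      exact Function.Periodic.differentiableAt_cuspFunction one_ne_zero hEper (hEd w hwpos)
    · have hre := hΦu w hwpos
      rw [hwω] at hre
      have hE : E w = Complex.exp (Φ w / 2 - Complex.I * κ * w / 2) := if_pos hwpos
      have hre2 : (Φ w / 2 - Complex.I * κ * w / 2).re
          = Real.log (g.density ω) / 2 + κ * w.im / 2 := by
        rw [← hre]
        simp [Complex.mul_re, Complex.mul_im]
        ring
      rw [hHω, hE, Complex.norm_exp, hre2, ← Real.exp_nat_mul, Real.rpow_def_of_pos hω.1,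
        ← Real.exp_add, hwim]
      rw [show Real.log ‖ω‖ * (κ / (2 * Real.pi)) + ((2 : ℕ) : ℝ) * (Real.log (g.density ω) / 2 +
        κ * (-1 / (2 * Real.pi) * Real.log ‖ω‖) / 2) = Real.log (g.density ω) by
        push_cast; ring, Real.exp_log (g.pos ω hω)]
  -- With `2m ≥ K + κ/2π`, the function `ω^m H` satisfies `|ω^m H|² ≤ ρ |ω|^K ≤ C`, so its
  -- singularity is removable.
  obtain ⟨m, hm⟩ := exists_nat_ge ((K + κ / (2 * Real.pi)) / 2)
  let T : ℂ → ℂ := fun ω => ω ^ m * H ω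
  have hdisk : ∀ᶠ ω in 𝓝[≠] (0 : ℂ), ω ∈ puncturedDisk := by
    filter_upwards [mem_nhdsWithin_of_mem_nhds (ball_mem_nhds (0 : ℂ) one_pos),
      self_mem_nhdsWithin] with ω h1 h2
    exact ⟨norm_pos_iff.mpr h2, mem_ball_zero_iff.mp h1⟩
  have hT : ∀ ω ∈ puncturedDisk,
      g.density ω = ‖ω‖ ^ (κ / (2 * Real.pi) - 2 * m) * ‖T ω‖ ^ 2 := by
    intro ω hω
    rw [(hpt ω hω).2, norm_mul, norm_pow, mul_pow, ← pow_mul, ← mul_assoc,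
      show κ / (2 * Real.pi) - 2 * m = κ / (2 * Real.pi) - ((m * 2 : ℕ) : ℝ) by push_cast; ring,
      Real.rpow_sub_natCast hω.1.ne', div_mul_cancel₀ _ (pow_ne_zero _ hω.1.ne')]
  have hTb : ∀ᶠ ω in 𝓝[≠] (0 : ℂ), ‖T ω‖ ^ 2 ≤ C := by
    filter_upwards [hKC, hdisk] with ω h1 h2
    refine le_trans ?_ h1
    rw [hT ω h2, mul_right_comm, ← Real.rpow_natCast ‖ω‖ K, ← Real.rpow_add h2.1]
    have : 1 ≤ ‖ω‖ ^ (κ / (2 * Real.pi) - 2 * m + K) :=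
      Real.one_le_rpow_of_pos_of_le_one_of_nonpos h2.1 h2.2.le (by linarith)
    exact le_mul_of_one_le_left (by positivity) this
  have hTd : ∀ᶠ ω in 𝓝[≠] (0 : ℂ), DifferentiableAt ℂ T ω := by
    filter_upwards [hdisk] with ω hω
    exact (differentiableAt_id.pow m).mul (hpt ω hω).1
  have hlim := Complex.tendsto_limUnder_of_differentiable_on_punctured_nhds_of_bounded_under hTd (by
    refine ⟨(C + 1) + ‖T 0‖, ?_⟩
    rw [eventually_map]
    filter_upwards [hTb] with ω hω
    refine (norm_sub_le _ _).trans ?_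
    nlinarith [norm_nonneg (T ω)])
  let T₀ : ℂ → ℂ := Function.update T 0 (limUnder (𝓝[≠] 0) T)
  have hT₀T : ∀ ω ≠ 0, T₀ ω = T ω := fun ω hω => Function.update_of_ne hω _ _
  have hT₀ : AnalyticAt ℂ T₀ 0 := by
    refine Complex.analyticAt_of_differentiable_on_punctured_nhds_of_continuousAt ?_
      (continuousAt_update_same.mpr hlim)
    filter_upwards [hTd, self_mem_nhdsWithin] with ω h1 h2
    refine h1.congr_of_eventuallyEq ?_
    filter_upwards [isOpen_ne.mem_nhds h2] with x hx using hT₀T x hx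
  -- Positivity of `ρ` excludes an identically zero germ, so the order `k` at the origin is finite.
  have hne : ¬ ∀ᶠ ω in 𝓝 0, T₀ ω = 0 := by
    intro h
    obtain ⟨ω, ⟨h1, h2⟩, h3⟩ := (((h.filter_mono nhdsWithin_le_nhds).and hdisk).and
      (self_mem_nhdsWithin (s := {(0 : ℂ)}ᶜ))).exists
    have := hT ω h2
    rw [← hT₀T ω h3, h1] at this
    have hp := g.pos ω h2
    simp at this
    linarith
  obtain ⟨k, G, hG, hG0, hk⟩ := hT₀.exists_eventuallyEq_pow_smul_nonzero_iff.mpr hne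
  refine ⟨κ / (4 * Real.pi) - m + k, G, hG, hG0, ?_⟩
  filter_upwards [hk.filter_mono nhdsWithin_le_nhds, hdisk] with ω h1 h2
  rw [hT ω h2, ← hT₀T ω (norm_pos_iff.mp h2.1), h1, sub_zero, smul_eq_mul, norm_mul, norm_pow,
    mul_pow, ← pow_mul, ← mul_assoc,
    show 2 * (κ / (4 * Real.pi) - m + k) = κ / (2 * Real.pi) - 2 * m + ((k * 2 : ℕ) : ℝ) by
      push_cast; field_simp; ring, Real.rpow_add_natCast h2.1.ne']

/-! ### The three normal forms as one-forms. -/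

namespace LocalForm

/-- The number `α` for which the density is `‖ω‖ ^ (2 * (α - 1))` times a positive continuous
function. -/
def weight : LocalForm → ℝ
  | power β => β + 1
  | cylinder _ => 0
  | pole _ n => -n

/-- The modulus of the residue of the holomorphic one-form underlying the metric. -/
def residue : LocalForm → ℝ
  | power _ => 0
  | cylinder c => c
  | pole ν _ => ν

/-- The exponent of `ω` in the residue term of the one-form; zero for the first two forms. -/
def poleOrder : LocalForm → ℕ
  | power _ => 0
  | cylinder _ => 0
  | pole _ n => n

/-- The regular part of a primitive of the one-form, in the coordinate `z = ω exp (s ω)`. -/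
def potential : LocalForm → (ℂ → ℂ) → ℂ → ℂ
  | power β, s => fun ω => Complex.exp (((β + 1 : ℝ) : ℂ) * s ω)
  | cylinder c, s => fun ω => c * s ω
  | pole ν n, s => fun ω => Complex.exp (-n * s ω) + ν * ω ^ n * s ω

/-- The one-form in the coordinate `z = ω exp (s ω)`, divided by `ω ^ (weight - 1) dω`. -/
def oneForm (F : LocalForm) (s : ℂ → ℂ) (ω : ℂ) : ℂ :=
  (F.weight : ℂ) * F.potential s ω + ω * deriv (F.potential s) ω + F.residue * ω ^ F.poleOrder

theorem analyticAt_potential (F : LocalForm) {s : ℂ → ℂ} {ω : ℂ} (hs : AnalyticAt ℂ s ω) :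
    AnalyticAt ℂ (F.potential s) ω := by
  cases F with
  | power β => exact (analyticAt_const.mul hs).cexp
  | cylinder c => exact analyticAt_const.mul hs
  | pole ν n =>
    exact (analyticAt_const.mul hs).cexp.add
      ((analyticAt_const.mul (analyticAt_id.pow n)).mul hs)

theorem analyticAt_oneForm (F : LocalForm) {s : ℂ → ℂ} {ω : ℂ} (hs : AnalyticAt ℂ s ω) :
    AnalyticAt ℂ (F.oneForm s) ω :=
  ((analyticAt_const.mul (F.analyticAt_potential hs)).add
    (analyticAt_id.mul (F.analyticAt_potential hs).deriv)).add
    (analyticAt_const.mul (analyticAt_id.pow _))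

/-- The value at `0` is `β + 1` or `-n` times an exponential, or `c`; admissibility keeps each
nonzero. -/
theorem oneForm_zero_ne_zero {F : LocalForm} (hF : F.Admissible) (s : ℂ → ℂ) :
    F.oneForm s 0 ≠ 0 := by
  cases F with
  | power β =>
    have h : ((β + 1 : ℝ) : ℂ) ≠ 0 := by
      intro h
      have : β + 1 = 0 := by exact_mod_cast h
      exact hF (by linarith)
    simpa [oneForm, weight, potential, residue] using! h
  | cylinder c =>
    have h : (c : ℂ) ≠ 0 := by exact_mod_cast (show (0 : ℝ) < c from hF).ne'
    simpa [oneForm, weight, potential, residue, poleOrder] using h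
  | pole ν n =>
    have h : n ≠ 0 := by
      have := hF.2
      omega
    simp [oneForm, weight, potential, residue, poleOrder, h]

theorem residue_nonneg {F : LocalForm} (hF : F.Admissible) : 0 ≤ F.residue := by
  cases F with
  | power β => exact le_rfl
  | cylinder c => exact (show 0 < c from hF).le
  | pole ν n => exact hF.1.le

theorem weight_eq_of_residue_ne_zero {F : LocalForm} (hr : F.residue ≠ 0) :
    F.weight = -(F.poleOrder : ℝ) := by
  cases F with
  | power β => exact absurd rfl hr
  | cylinder c => simp [weight, poleOrder]
  | pole ν n => rfl

/-- Among admissible forms only `power (-n - 1)` and the `pole _ n` share a weight without being of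
the same kind, and the residue (`0` against `ν > 0`) separates them. Within a kind, weight and
residue recover the constants. -/
theorem eq_of_weight_eq_of_residue_eq {F F' : LocalForm} (hF : F.Admissible) (hF' : F'.Admissible)
    (hw : F.weight = F'.weight) (hr : F.residue = F'.residue) : F = F' := by
  cases F <;> cases F' <;> simp only [weight, residue, Admissible, power.injEq, cylinder.injEq,
    pole.injEq, reduceCtorEq, neg_inj, Nat.cast_inj] at * <;>
    first
    | linarith
    | exact ⟨hr, hw⟩
    | skip
  · rename_i c ν n
    have : n = 0 := by exact_mod_cast (neg_eq_zero.mp hw.symm)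
    omega
  · rename_i ν n c
    have : n = 0 := by exact_mod_cast (neg_eq_zero.mp hw)
    omega

/-- The density of the metric `F` in terms of the coordinate `ω`, where `z = ω exp (s ω)`. -/
theorem coeff_mul_norm_deriv_sq (F : LocalForm) {s : ℂ → ℂ} {ω : ℂ}
    (hs : DifferentiableAt ℂ s ω) (hω : ω ≠ 0) :
    F.coeff (ω * Complex.exp (s ω)) *
        ‖Complex.exp (s ω) + ω * (Complex.exp (s ω) * deriv s ω)‖ ^ 2 =
      ‖ω‖ ^ (2 * (F.weight - 1)) * ‖F.oneForm s ω‖ ^ 2 := by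
  have hpos : 0 < ‖ω‖ := norm_pos_iff.mpr hω
  have hfac : Complex.exp (s ω) + ω * (Complex.exp (s ω) * deriv s ω)
      = Complex.exp (s ω) * (1 + ω * deriv s ω) := by ring
  cases F with
  | power β =>
    have hd : HasDerivAt (potential (power β) s)
        (Complex.exp (((β + 1 : ℝ) : ℂ) * s ω) * (((β + 1 : ℝ) : ℂ) * deriv s ω)) ω :=
      (hs.hasDerivAt.const_mul _).cexp
    have h1 : oneForm (power β) s ω = ((β + 1 : ℝ) : ℂ) *
        (Complex.exp (((β + 1 : ℝ) : ℂ) * s ω) * (1 + ω * deriv s ω)) := by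
      rw [oneForm, hd.deriv]
      simp only [weight, residue, potential]
      push_cast
      ring
    rw [h1, hfac]
    simp only [coeff, weight, norm_mul, Complex.norm_exp, Complex.norm_real, Complex.re_ofReal_mul,
      mul_pow, Real.norm_eq_abs, sq_abs]
    rw [Real.mul_rpow hpos.le (Real.exp_pos _).le, ← Real.exp_mul, ← Real.exp_nat_mul,
      ← Real.exp_nat_mul, add_sub_cancel_right]
    have h2 : Real.exp ((s ω).re * (2 * β)) * Real.exp (((2 : ℕ) : ℝ) * (s ω).re)
        = Real.exp (((2 : ℕ) : ℝ) * ((β + 1) * (s ω).re)) := by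
      rw [← Real.exp_add]
      congr 1
      push_cast
      ring
    rw [← h2]
    ring
  | cylinder c =>
    have hd : HasDerivAt (potential (cylinder c) s) (c * deriv s ω) ω := hs.hasDerivAt.const_mul _
    have h1 : oneForm (cylinder c) s ω = c * (1 + ω * deriv s ω) := by
      rw [oneForm, hd.deriv]
      simp only [weight, residue, potential, poleOrder]
      push_cast
      ring
    rw [h1, hfac]
    simp only [coeff, weight, norm_mul, Complex.norm_real, mul_pow, Real.norm_eq_abs, sq_abs]
    rw [show (2 : ℝ) * (0 - 1) = ((-2 : ℤ) : ℝ) by norm_num, Real.rpow_intCast, mul_zpow]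
    have : ‖Complex.exp (s ω)‖ ≠ 0 := norm_ne_zero_iff.mpr (Complex.exp_ne_zero _)
    simp only [zpow_neg]
    norm_cast
    field_simp
  | pole ν n =>
    have hd : HasDerivAt (potential (pole ν n) s)
        (Complex.exp (-n * s ω) * (-n * deriv s ω) +
          (ν * (n * ω ^ (n - 1)) * s ω + ν * ω ^ n * deriv s ω)) ω :=
      (hs.hasDerivAt.const_mul _).cexp.add
        (((hasDerivAt_pow n ω).const_mul (ν : ℂ)).mul hs.hasDerivAt)
    -- The case `n = 0` is separate because `n - 1` truncates.
    have hn : ω * ((n : ℂ) * ω ^ (n - 1)) = n * ω ^ n := by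
      rcases n with _ | n
      · simp
      · rw [Nat.add_sub_cancel, pow_succ]; ring
    have h1 : oneForm (pole ν n) s ω =
        (ν * ω ^ n - n * Complex.exp (-n * s ω)) * (1 + ω * deriv s ω) := by
      rw [oneForm, hd.deriv]
      simp only [weight, residue, potential, poleOrder]
      push_cast
      linear_combination (ν : ℂ) * s ω * hn
    have he : Complex.exp (-n * s ω) = (Complex.exp (s ω) ^ n)⁻¹ := by
      rw [← Complex.exp_nat_mul, ← Complex.exp_neg, neg_mul]
    have hE := Complex.exp_ne_zero (s ω)
    have h2 : (ν : ℂ) / (ω * Complex.exp (s ω)) - n / (ω * Complex.exp (s ω)) ^ (n + 1)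
        = (ω ^ (n + 1) * Complex.exp (s ω))⁻¹ * (ν * ω ^ n - n * Complex.exp (-n * s ω)) := by
      rw [he]
      field_simp
      ring
    rw [h1, hfac]
    simp only [coeff, weight]
    rw [h2, show (2 : ℝ) * (-(n : ℝ) - 1) = ((-(2 * (n + 1) : ℕ) : ℤ) : ℝ) by push_cast; ring,
      Real.rpow_intCast, zpow_neg, zpow_natCast]
    have hE' : ‖Complex.exp (s ω)‖ ≠ 0 := norm_ne_zero_iff.mpr hE
    simp only [norm_mul, norm_inv, norm_pow]
    field_simp
    ring

end LocalForm

/-! ### Passage between coordinates and germs. -/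

open LocalForm

/-- Injectivity makes the zero of `z` simple, so the coordinate is encoded by the germ `s`, on which
all comparisons are carried out. -/
theorem IsNormalCoordinate.exists_germ {g : ConformalMetric puncturedDisk} {F : LocalForm} {ε : ℝ}
    {z : ℂ → ℂ} (h : IsNormalCoordinate g F ε z) :
    ∃ s : ℂ → ℂ, AnalyticAt ℂ s 0 ∧ (∀ᶠ ω in 𝓝 0, z ω = ω * Complex.exp (s ω)) ∧
      ∀ᶠ ω in 𝓝[≠] 0, g.density ω = ‖ω‖ ^ (2 * (F.weight - 1)) * ‖F.oneForm s ω‖ ^ 2 := by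
  have hball := ball_mem_nhds (0 : ℂ) h.pos
  obtain ⟨s, hs, hzs⟩ := (h.isCentredCoordinate.differentiableOn.analyticAt
    hball).exists_eq_mul_cexp_of_injOn h.isCentredCoordinate.map_zero hball
    h.isCentredCoordinate.injOn
  refine ⟨s, hs, hzs, ?_⟩
  filter_upwards [hzs.eventually_nhds.filter_mono nhdsWithin_le_nhds,
    hs.eventually_analyticAt.filter_mono nhdsWithin_le_nhds,
    mem_nhdsWithin_of_mem_nhds hball, self_mem_nhdsWithin] with ω h1 h2 h3 hne
  have hd : HasDerivAt z (Complex.exp (s ω) + ω * (Complex.exp (s ω) * deriv s ω)) ω := by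
    refine HasDerivAt.congr_of_eventuallyEq ?_ h1
    simpa using! (hasDerivAt_id ω).fun_mul h2.differentiableAt.hasDerivAt.cexp
  rw [h.metric_eq ω h3 hne, hd.deriv, h1.self_of_nhds,
    F.coeff_mul_norm_deriv_sq h2.differentiableAt hne]

/-- The function `ω exp (s ω)` has nonzero derivative at `0`, hence is injective on a small disc. -/
theorem exists_isNormalCoordinate {g : ConformalMetric puncturedDisk} {F : LocalForm} {s : ℂ → ℂ}
    (hs : AnalyticAt ℂ s 0)
    (h : ∀ᶠ ω in 𝓝[≠] 0, g.density ω = ‖ω‖ ^ (2 * (F.weight - 1)) * ‖F.oneForm s ω‖ ^ 2) :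
    ∃ (ε : ℝ) (z : ℂ → ℂ), IsNormalCoordinate g F ε z := by
  let z : ℂ → ℂ := fun ω => ω * Complex.exp (s ω)
  have hz : AnalyticAt ℂ z 0 := analyticAt_id.mul hs.cexp
  have hder : ∀ ω, AnalyticAt ℂ s ω →
      HasDerivAt z (Complex.exp (s ω) + ω * (Complex.exp (s ω) * deriv s ω)) ω := fun ω hω => by
    simpa using! (hasDerivAt_id ω).fun_mul hω.differentiableAt.hasDerivAt.cexp
  have hd0 : deriv z 0 ≠ 0 := by
    rw [(hder 0 hs).deriv]
    simp
  have hinj : ∃ U ∈ 𝓝 (0 : ℂ), InjOn z U := by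
    refine ⟨_, hz.hasStrictDerivAt.eventually_left_inverse hd0, fun x hx y hy hxy => ?_⟩
    have hx' : HasStrictDerivAt.localInverse z (deriv z 0) 0 hz.hasStrictDerivAt hd0 (z x) = x := hx
    have hy' : HasStrictDerivAt.localInverse z (deriv z 0) 0 hz.hasStrictDerivAt hd0 (z y) = y := hy
    rw [← hx', ← hy', hxy]
  obtain ⟨U, hU, hUinj⟩ := hinj
  obtain ⟨δ, hδ, hball⟩ := Metric.eventually_nhds_iff_ball.mp
    ((hs.eventually_analyticAt.and (eventually_nhdsWithin_iff.mp h)).and hU)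
  have hsub : ball (0 : ℂ) (min δ 1) ⊆ ball 0 δ := ball_subset_ball (min_le_left _ _)
  refine ⟨min δ 1, z, lt_min hδ one_pos, min_le_right _ _, ⟨?_, ?_, by simp [z]⟩, ?_⟩
  · intro ω hω
    exact (hder ω (hball ω (hsub hω)).1.1).differentiableAt.differentiableWithinAt
  · exact hUinj.mono fun ω hω => (hball ω (hsub hω)).2
  · intro ω hω hne
    obtain ⟨⟨h1, h2⟩, -⟩ := hball ω (hsub hω)
    rw [h2 hne, (hder ω h1).deriv, F.coeff_mul_norm_deriv_sq h1.differentiableAt hne]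

/-! ### Uniqueness of the form and its constants. -/

/-- Exponents at the origin are determined by the density. -/
theorem exponent_le_of_eventuallyEq {a b : ℝ} {f h : ℂ → ℂ} (hf : ContinuousAt f 0)
    (hh : ContinuousAt h 0) (h0 : h 0 ≠ 0)
    (heq : ∀ᶠ ω in 𝓝[≠] (0 : ℂ), ‖ω‖ ^ a * ‖f ω‖ ^ 2 = ‖ω‖ ^ b * ‖h ω‖ ^ 2) : a ≤ b := by
  by_contra! hlt
  have hpos : 0 < a - b := sub_pos.mpr hlt
  have h1 : ∀ᶠ ω in 𝓝[≠] (0 : ℂ), ‖ω‖ ^ (a - b) * ‖f ω‖ ^ 2 = ‖h ω‖ ^ 2 := by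
    filter_upwards [heq, self_mem_nhdsWithin] with ω hω hne
    have hn : 0 < ‖ω‖ := norm_pos_iff.mpr hne
    apply mul_left_cancel₀ (Real.rpow_pos_of_pos hn b).ne'
    rw [← hω, ← mul_assoc, ← Real.rpow_add hn, add_sub_cancel]
  have h2 : Tendsto (fun ω : ℂ => ‖ω‖ ^ (a - b) * ‖f ω‖ ^ 2) (𝓝[≠] 0) (𝓝 0) := by
    have : ContinuousAt (fun ω : ℂ => ‖ω‖ ^ (a - b) * ‖f ω‖ ^ 2) 0 :=
      (continuousAt_id.norm.rpow_const (Or.inr hpos.le)).mul (hf.norm.pow 2)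
    have ht := this.tendsto
    simp only [norm_zero, Real.zero_rpow hpos.ne', zero_mul] at ht
    exact ht.mono_left nhdsWithin_le_nhds
  have h3 : Tendsto (fun ω : ℂ => ‖h ω‖ ^ 2) (𝓝[≠] 0) (𝓝 (‖h 0‖ ^ 2)) :=
    (hh.norm.pow 2).tendsto.mono_left nhdsWithin_le_nhds
  have h4 := tendsto_nhds_unique (h2.congr' h1) h3
  exact h0 (norm_eq_zero.mp (pow_eq_zero_iff two_ne_zero |>.mp h4.symm))

/-- Two normal forms of the same density have the same weight, and their one-forms agree up to a
unimodular constant. -/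
theorem weight_eq_and_exists_oneForm_eq {ρ : ℂ → ℝ} {F F' : LocalForm} (hF : F.Admissible)
    (hF' : F'.Admissible) {s t : ℂ → ℂ} (hs : AnalyticAt ℂ s 0) (ht : AnalyticAt ℂ t 0)
    (h : ∀ᶠ ω in 𝓝[≠] 0, ρ ω = ‖ω‖ ^ (2 * (F.weight - 1)) * ‖F.oneForm s ω‖ ^ 2)
    (h' : ∀ᶠ ω in 𝓝[≠] 0, ρ ω = ‖ω‖ ^ (2 * (F'.weight - 1)) * ‖F'.oneForm t ω‖ ^ 2) :
    F.weight = F'.weight ∧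
      ∃ l : ℂ, ‖l‖ = 1 ∧ ∀ᶠ ω in 𝓝 0, F.oneForm s ω = l * F'.oneForm t ω := by
  have hP := F.analyticAt_oneForm hs
  have hQ := F'.analyticAt_oneForm ht
  have heq := h.and h' |>.mono fun ω hω => hω.1.symm.trans hω.2
  have h1 := exponent_le_of_eventuallyEq hP.continuousAt hQ.continuousAt
    (oneForm_zero_ne_zero hF' t) heq
  have h2 := exponent_le_of_eventuallyEq hQ.continuousAt hP.continuousAt
    (oneForm_zero_ne_zero hF s) (heq.mono fun _ hω => hω.symm)
  have hw : F.weight = F'.weight := by linarith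
  refine ⟨hw, hP.exists_unimodular_mul_eq hQ (oneForm_zero_ne_zero hF' t) ?_⟩
  filter_upwards [heq, self_mem_nhdsWithin] with ω hω hne
  rw [hw] at hω
  have hn : 0 < ‖ω‖ := norm_pos_iff.mpr hne
  exact (pow_left_inj₀ (norm_nonneg _) (norm_nonneg _) two_ne_zero).mp
    (mul_left_cancel₀ (Real.rpow_pos_of_pos hn _).ne' hω)

/-- The Euler equation for the difference of two potentials. -/
theorem euler_potential_sub {F F' : LocalForm} {s t : ℂ → ℂ} (hs : AnalyticAt ℂ s 0)
    (ht : AnalyticAt ℂ t 0) (hw : F.weight = F'.weight) {l : ℂ}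
    (hl : ∀ᶠ ω in 𝓝 0, F.oneForm s ω = l * F'.oneForm t ω) :
    ∀ᶠ ω in 𝓝 0, (F.weight : ℂ) * (F.potential s ω - l * F'.potential t ω) +
      ω * deriv (fun w => F.potential s w - l * F'.potential t w) ω =
      l * F'.residue * ω ^ F'.poleOrder - F.residue * ω ^ F.poleOrder := by
  filter_upwards [hl, hs.eventually_analyticAt, ht.eventually_analyticAt] with ω hω h1 h2
  have hd := (F.analyticAt_potential h1).differentiableAt.hasDerivAt.sub
    ((F'.analyticAt_potential h2).differentiableAt.hasDerivAt.const_mul l)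
  have hd' : deriv (fun w => F.potential s w - l * F'.potential t w) ω
      = deriv (F.potential s) ω - l * deriv (F'.potential t) ω := hd.deriv
  rw [hd']
  simp only [oneForm, ← hw] at hω
  linear_combination hω

/-- The difference of potentials satisfies an Euler equation whose right side is a multiple of `ω^n`
when the weight is `-n`. That multiple must vanish, so the residues agree up to a unimodular factor.
For other weights both residues are zero. -/
theorem LocalForm.eq_of_density_eq {ρ : ℂ → ℝ} {F F' : LocalForm} (hF : F.Admissible)
    (hF' : F'.Admissible) {s t : ℂ → ℂ} (hs : AnalyticAt ℂ s 0) (ht : AnalyticAt ℂ t 0)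
    (h : ∀ᶠ ω in 𝓝[≠] 0, ρ ω = ‖ω‖ ^ (2 * (F.weight - 1)) * ‖F.oneForm s ω‖ ^ 2)
    (h' : ∀ᶠ ω in 𝓝[≠] 0, ρ ω = ‖ω‖ ^ (2 * (F'.weight - 1)) * ‖F'.oneForm t ω‖ ^ 2) :
    F = F' := by
  obtain ⟨hw, l, hl, hlF⟩ := weight_eq_and_exists_oneForm_eq hF hF' hs ht h h'
  refine eq_of_weight_eq_of_residue_eq hF hF' hw ?_
  by_cases hn : ∃ n : ℕ, F.weight = -n
  · obtain ⟨n, hn⟩ := hn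
    -- A `power` form may have `poleOrder` different from `n`, but then its residue is zero.
    have hres : ∀ H : LocalForm, H.weight = -n → ∀ ω : ℂ,
        (H.residue : ℂ) * ω ^ H.poleOrder = H.residue * ω ^ n := by
      intro H hH ω
      by_cases hr : H.residue = 0
      · simp [hr]
      · have := weight_eq_of_residue_ne_zero hr
        rw [hH, neg_inj, Nat.cast_inj] at this
        rw [this]
    have hD : AnalyticAt ℂ (fun w => F.potential s w - l * F'.potential t w) 0 :=
      (F.analyticAt_potential hs).sub (analyticAt_const.mul (F'.analyticAt_potential ht))
    have hzero := hD.eq_zero_of_euler_eq_monomial n (c := l * F'.residue - F.residue) (by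
      filter_upwards [euler_potential_sub hs ht hw hlF] with ω hω
      rw [mul_assoc, hres F hn, hres F' (hw ▸ hn), hn] at hω
      push_cast at hω
      linear_combination hω)
    have hnorm := congrArg norm (sub_eq_zero.mp hzero)
    rwa [norm_mul, hl, one_mul, Complex.norm_real, Complex.norm_real,
      Real.norm_of_nonneg (residue_nonneg hF), Real.norm_of_nonneg (residue_nonneg hF'),
      eq_comm] at hnorm
  · have hres : ∀ H : LocalForm, H.weight = F.weight → H.residue = 0 := by
      intro H hH
      by_contra hr
      exact hn ⟨H.poleOrder, hH ▸ weight_eq_of_residue_ne_zero hr⟩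
    rw [hres F rfl, hres F' hw.symm]

/-! ### Existence of a normal form. -/

/-- Every density `‖ω‖ ^ (2 b) * ‖G ω‖ ^ 2` with `G` nonvanishing has an admissible normal form. -/
theorem LocalForm.exists_oneForm_norm_eq (b : ℝ) {G : ℂ → ℂ} (hG : AnalyticAt ℂ G 0)
    (hG0 : G 0 ≠ 0) :
    ∃ (F : LocalForm) (s : ℂ → ℂ), F.Admissible ∧ AnalyticAt ℂ s 0 ∧ F.weight = b + 1 ∧
      ∀ᶠ ω in 𝓝 0, ‖F.oneForm s ω‖ = ‖G ω‖ := by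
  obtain ⟨m, hm⟩ := exists_nat_ge (-b)
  obtain ⟨A, r, n, hA, hr, hAG⟩ := hG.exists_euler_add_monomial_eq m (α := b + 1) (by linarith)
  have hA0 := hAG.self_of_nhds
  rw [zero_mul, add_zero] at hA0
  -- The one-form only depends on the germ of the potential.
  have key : ∀ (F : LocalForm) (s : ℂ → ℂ) (l : ℂ), ‖l‖ = 1 → F.weight = b + 1 →
      F.potential s =ᶠ[𝓝 0] (fun ω => l * A ω) →
      (∀ ω : ℂ, (F.residue : ℂ) * ω ^ F.poleOrder = l * (r * ω ^ n)) →
      ∀ᶠ ω in 𝓝 0, ‖F.oneForm s ω‖ = ‖G ω‖ := by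
    intro F s l hl hw hpot hres
    filter_upwards [hpot.eventually_nhds, hAG, hA.eventually_analyticAt] with ω h1 h2 h3
    have hd : deriv (F.potential s) ω = l * deriv A ω :=
      ((h3.differentiableAt.hasDerivAt.const_mul l).congr_of_eventuallyEq h1).deriv
    have : F.oneForm s ω = l * G ω := by
      rw [oneForm, hd, hres, hw, h1.self_of_nhds, ← h2]
      ring
    rw [this, norm_mul, hl, one_mul]
  by_cases hr0 : r = 0
  · rw [hr0, zero_mul, add_zero] at hA0
    have hb : ((b + 1 : ℝ) : ℂ) ≠ 0 := by
      intro h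
      rw [h, zero_mul] at hA0
      exact hG0 hA0.symm
    have hA00 : A 0 ≠ 0 := by
      intro h
      rw [h, mul_zero] at hA0
      exact hG0 hA0.symm
    obtain ⟨L, hL, hLA⟩ := hA.exists_cexp_eq hA00
    refine ⟨power b, fun ω => L ω / ((b + 1 : ℝ) : ℂ), ?_, hL.div analyticAt_const hb, rfl,
      key _ _ 1 norm_one rfl ?_ ?_⟩
    · intro h
      rw [h] at hb
      simp at hb
    · filter_upwards [hLA] with ω hω
      simp only [potential]
      rw [mul_div_cancel₀ _ hb, hω, one_mul]
    · intro ω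
      simp [residue, hr0]
  · have hrn : 0 < ‖r‖ := norm_pos_iff.mpr hr0
    have hrC : (‖r‖ : ℂ) ≠ 0 := by exact_mod_cast hrn.ne'
    -- This rotation makes the residue the positive number `‖r‖`.
    have hl : ‖(‖r‖ : ℂ) / r‖ = 1 := by
      rw [norm_div, Complex.norm_real, norm_norm, div_self hrn.ne']
    have hw := hr hr0
    rcases Nat.eq_zero_or_pos n with hn | hn
    · have hw0 : b + 1 = 0 := by rw [hw, hn]; simp
      refine ⟨cylinder ‖r‖, fun ω => A ω / r, hrn, hA.div analyticAt_const hr0, hw0.symm,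
        key _ _ ((‖r‖ : ℂ) / r) hl hw0.symm ?_ ?_⟩
      · refine Eventually.of_forall fun ω => ?_
        simp only [potential]
        ring
      · intro ω
        simp only [residue, poleOrder, hn]
        field_simp
    · have hA00 : (‖r‖ : ℂ) / r * A 0 ≠ 0 := by
        refine mul_ne_zero (div_ne_zero hrC hr0) ?_
        intro h
        rw [h, mul_zero, zero_add, zero_pow hn.ne', mul_zero] at hA0
        exact hG0 hA0.symm
      have hlA : AnalyticAt ℂ (fun ω => (‖r‖ : ℂ) / r * A ω) 0 := analyticAt_const.mul hA
      obtain ⟨s, hs, hsA⟩ := hlA.exists_cexp_add_pow_mul_eq hA00 (‖r‖ : ℂ) hn.ne'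
      refine ⟨pole ‖r‖ n, s, ⟨hrn, hn⟩, hs, hw.symm,
        key _ _ ((‖r‖ : ℂ) / r) hl hw.symm hsA ?_⟩
      intro ω
      simp only [residue, poleOrder]
      field_simp

/-! ### Uniqueness of the coordinates. -/

/-- Multiplying a normal coordinate by a constant preserving the metric form. -/
theorem IsNormalCoordinate.const_mul {g : ConformalMetric puncturedDisk} {F : LocalForm} {ε : ℝ}
    {z z' : ℂ → ℂ} (h : IsNormalCoordinate g F ε z) {a : ℂ} (ha : a ≠ 0)
    (hF : ∀ x, F.coeff (a * x) * ‖a‖ ^ 2 = F.coeff x)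
    (hz' : ∀ ω ∈ ball (0 : ℂ) ε, z' ω = a * z ω) : IsNormalCoordinate g F ε z' := by
  refine ⟨h.pos, h.le_one, ⟨?_, ?_, ?_⟩, ?_⟩
  · exact (h.isCentredCoordinate.differentiableOn.const_mul a).congr hz'
  · intro x hx y hy hxy
    rw [hz' x hx, hz' y hy] at hxy
    exact h.isCentredCoordinate.injOn hx hy (mul_left_cancel₀ ha hxy)
  · rw [hz' 0 (mem_ball_self h.pos), h.isCentredCoordinate.map_zero, mul_zero]
  · intro ω hω hne
    have hd : deriv z' ω = a * deriv z ω := by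
      have he : z' =ᶠ[𝓝 ω] fun w => a * z w := by
        filter_upwards [isOpen_ball.mem_nhds hω] with w hw using hz' w hw
      have hdz := (h.isCentredCoordinate.differentiableOn.differentiableAt
        (isOpen_ball.mem_nhds hω)).hasDerivAt
      exact ((hdz.const_mul a).congr_of_eventuallyEq he).deriv
    rw [hd, hz' ω hω, norm_mul, mul_pow, ← mul_assoc, hF, h.metric_eq ω hω hne]

/-- Proportionality of coordinates near the origin propagates to the whole disc. -/
theorem IsCentredCoordinate.eqOn_const_mul {ε : ℝ} (hε : 0 < ε) {z z' : ℂ → ℂ}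
    (hz : IsCentredCoordinate ε z) (hz' : IsCentredCoordinate ε z') {a : ℂ}
    (h : ∀ᶠ ω in 𝓝 0, z' ω = a * z ω) : ∀ ω ∈ ball (0 : ℂ) ε, z' ω = a * z ω := by
  have h1 : AnalyticOnNhd ℂ z' (ball 0 ε) := hz'.differentiableOn.analyticOnNhd isOpen_ball
  have h2 : AnalyticOnNhd ℂ (fun ω => a * z ω) (ball 0 ε) :=
    (hz.differentiableOn.const_mul a).analyticOnNhd isOpen_ball
  exact h1.eqOn_of_preconnected_of_eventuallyEq h2 (convex_ball _ _).isPreconnected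
    (mem_ball_self hε) h

/-- The condition on `β` keeps the weight `β + 1` out of `{0, -1, -2, …}`, so the homogeneous Euler
equation gives `exp ((β+1) s) = l exp ((β+1) t)` with `|l| = 1`. As `β + 1` is real and nonzero,
`exp s` and `exp t` have equal modulus. -/
theorem IsNormalCoordinate.exists_rotation {g : ConformalMetric puncturedDisk} {β : ℝ}
    (hβ : (β < -1 ∧ ∀ k : ℤ, β ≠ k) ∨ -1 < β) {ε : ℝ} {z z' : ℂ → ℂ}
    (h : IsNormalCoordinate g (power β) ε z) (h' : IsNormalCoordinate g (power β) ε z') :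
    ∃ a : ℂ, ‖a‖ = 1 ∧ ∀ ω ∈ ball (0 : ℂ) ε, z' ω = a * z ω := by
  have hadm : (power β).Admissible := by
    rintro rfl
    rcases hβ with hβ | hβ
    · exact lt_irrefl _ hβ.1
    · exact lt_irrefl _ hβ
  have hw : ∀ n : ℕ, (power β).weight ≠ -n := by
    intro n hn
    have hn' : β + 1 = -n := hn
    rcases hβ with hβ | hβ
    · refine hβ.2 (-n - 1) ?_
      push_cast
      linarith
    · have : (0 : ℝ) ≤ n := n.cast_nonneg
      linarith
  obtain ⟨s, hs, hzs, hds⟩ := h.exists_germ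
  obtain ⟨t, ht, hzt, hdt⟩ := h'.exists_germ
  obtain ⟨-, l, hl, hst⟩ := weight_eq_and_exists_oneForm_eq hadm hadm hs ht hds hdt
  have hD : AnalyticAt ℂ (fun w => (power β).potential s w - l * (power β).potential t w) 0 :=
    (analyticAt_potential _ hs).sub (analyticAt_const.mul (analyticAt_potential _ ht))
  have hzero := hD.eventually_eq_zero_of_euler_eq_zero hw (by
    filter_upwards [euler_potential_sub hs ht rfl hst] with ω hω
    simpa [residue] using hω)
  have hre : ∀ᶠ ω in 𝓝 (0 : ℂ), ‖Complex.exp (t ω)‖ = ‖Complex.exp (s ω)‖ := by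
    filter_upwards [hzero] with ω hω
    have h1 := congrArg norm (sub_eq_zero.mp hω)
    simp only [potential, norm_mul, hl, one_mul, Complex.norm_exp, Complex.re_ofReal_mul,
      Real.exp_eq_exp] at h1
    have hb : β + 1 ≠ 0 := by simpa using! hw 0
    rw [Complex.norm_exp, Complex.norm_exp, mul_left_cancel₀ hb h1]
  obtain ⟨a, ha, hst'⟩ := ht.cexp.exists_unimodular_mul_eq hs.cexp (Complex.exp_ne_zero _)
    (hre.filter_mono nhdsWithin_le_nhds)
  refine ⟨a, ha, h.isCentredCoordinate.eqOn_const_mul h.pos h'.isCentredCoordinate ?_⟩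
  filter_upwards [hzs, hzt, hst'] with ω h1 h2 h3
  simp only [Function.comp_apply] at h3
  rw [h1, h2, h3]
  ring

/-- At weight `0` the Euler equation reduces to `ω (s - t)' = 0`, which leaves an arbitrary constant
in `s - t`, hence a nonzero factor between the coordinates. -/
theorem IsNormalCoordinate.exists_scaling {g : ConformalMetric puncturedDisk} {c : ℝ}
    (hc : 0 < c) {ε : ℝ} {z z' : ℂ → ℂ}
    (h : IsNormalCoordinate g (cylinder c) ε z) (h' : IsNormalCoordinate g (cylinder c) ε z') :
    ∃ p : ℂ, p ≠ 0 ∧ ∀ ω ∈ ball (0 : ℂ) ε, z' ω = p * z ω := by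
  have hadm : (cylinder c).Admissible := hc
  have hcC : (c : ℂ) ≠ 0 := by exact_mod_cast hc.ne'
  obtain ⟨s, hs, hzs, hds⟩ := h.exists_germ
  obtain ⟨t, ht, hzt, hdt⟩ := h'.exists_germ
  obtain ⟨-, l, -, hst⟩ := weight_eq_and_exists_oneForm_eq hadm hadm hs ht hds hdt
  -- Both one-forms take the value `c` at the origin.
  have hl : l = 1 := by
    have h0 := hst.self_of_nhds
    simp only [oneForm, weight, residue, poleOrder, Complex.ofReal_zero, zero_mul, zero_add,
      pow_zero, mul_one] at h0
    exact mul_right_cancel₀ hcC (h0.symm.trans (one_mul _).symm)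
  subst hl
  have hder : ∀ᶠ ω in 𝓝[≠] (0 : ℂ), deriv (fun w => s w - t w) ω = 0 := by
    filter_upwards [(euler_potential_sub hs ht rfl hst).filter_mono nhdsWithin_le_nhds,
      hs.eventually_analyticAt.filter_mono nhdsWithin_le_nhds,
      ht.eventually_analyticAt.filter_mono nhdsWithin_le_nhds, self_mem_nhdsWithin]
      with ω hω h1 h2 hne
    have hd : deriv (fun w => (cylinder c).potential s w - 1 * (cylinder c).potential t w) ω
        = c * deriv (fun w => s w - t w) ω := by
      rw [← deriv_const_mul _ (h1.differentiableAt.fun_sub h2.differentiableAt)]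
      congr 1
      funext w
      simp only [potential]
      ring
    rw [hd] at hω
    simpa [weight, hcC, show ω ≠ 0 from hne] using hω
  have hD : AnalyticAt ℂ (fun w => s w - t w) 0 := hs.sub ht
  have hder' := (hD.deriv.frequently_eq_iff_eventually_eq (analyticAt_const (v := (0 : ℂ)))).mp
    hder.frequently
  obtain ⟨δ, hδ, hball⟩ := Metric.eventually_nhds_iff_ball.mp (hder'.and hD.eventually_analyticAt)
  have hconst : ∀ ω ∈ ball (0 : ℂ) δ, s ω - t ω = s 0 - t 0 := fun ω hω =>
    isOpen_ball.is_const_of_deriv_eq_zero (convex_ball _ _).isPreconnected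
      (f := fun w => s w - t w) (fun x hx => (hball x hx).2.differentiableAt.differentiableWithinAt)
      (fun x hx => (hball x hx).1) hω (mem_ball_self hδ)
  refine ⟨Complex.exp (t 0 - s 0), Complex.exp_ne_zero _,
    h.isCentredCoordinate.eqOn_const_mul h.pos h'.isCentredCoordinate ?_⟩
  filter_upwards [hzs, hzt, ball_mem_nhds (0 : ℂ) hδ] with ω h1 h2 h3
  rw [h1, h2, mul_left_comm, ← Complex.exp_add]
  congr 2
  linear_combination -hconst ω h3

theorem LocalForm.coeff_power_const_mul (β : ℝ) {a : ℂ} (ha : ‖a‖ = 1) (x : ℂ) :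
    (power β).coeff (a * x) * ‖a‖ ^ 2 = (power β).coeff x := by
  simp [coeff, ha]

theorem LocalForm.coeff_cylinder_const_mul (c : ℝ) {a : ℂ} (ha : a ≠ 0) (x : ℂ) :
    (cylinder c).coeff (a * x) * ‖a‖ ^ 2 = (cylinder c).coeff x := by
  have : ‖a‖ ≠ 0 := norm_ne_zero_iff.mpr ha
  simp only [coeff, norm_mul, mul_zpow, zpow_neg]
  norm_cast
  field_simp

end

theorem theorem1p2 (g : ConformalMetric puncturedDisk)
    (hflat : ∀ ω ∈ puncturedDisk, g.gaussCurvature ω = 0)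
    (hgrowth : HasPolynomialAreaGrowth g) :
    -- existence of a normal form, and uniqueness of the form and of its constants
    (∃! F : LocalForm, F.Admissible ∧ ∃ (ε : ℝ) (z : ℂ → ℂ), IsNormalCoordinate g F ε z) ∧
    -- first form: the coordinate is unique exactly up to rotations
    (∀ β : ℝ, ((β < -1 ∧ ∀ k : ℤ, β ≠ k) ∨ -1 < β) →
      ∀ (ε : ℝ) (z z' : ℂ → ℂ), IsNormalCoordinate g (LocalForm.power β) ε z →
        (IsNormalCoordinate g (LocalForm.power β) ε z' ↔
          ∃ a : ℂ, ‖a‖ = 1 ∧ ∀ ω ∈ ball (0 : ℂ) ε, z' ω = a * z ω)) ∧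
    -- second form: the coordinate is unique exactly up to nonzero scalars
    (∀ c : ℝ, 0 < c →
      ∀ (ε : ℝ) (z z' : ℂ → ℂ), IsNormalCoordinate g (LocalForm.cylinder c) ε z →
        (IsNormalCoordinate g (LocalForm.cylinder c) ε z' ↔
          ∃ p : ℂ, p ≠ 0 ∧ ∀ ω ∈ ball (0 : ℂ) ε, z' ω = p * z ω)) := by
  refine ⟨?_, ?_, ?_⟩
  · obtain ⟨b, G, hG, hG0, hdens⟩ := g.exists_density_eq hflat hgrowth
    obtain ⟨F, s, hF, hs, hw, hnorm⟩ := LocalForm.exists_oneForm_norm_eq b hG hG0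
    have hds : ∀ᶠ ω in nhdsWithin 0 {0}ᶜ,
        g.density ω = ‖ω‖ ^ (2 * (F.weight - 1)) * ‖F.oneForm s ω‖ ^ 2 := by
      filter_upwards [hdens, hnorm.filter_mono nhdsWithin_le_nhds] with ω h1 h2
      rw [h1, h2, hw, add_sub_cancel_right]
    refine ⟨F, ⟨hF, exists_isNormalCoordinate hs hds⟩, ?_⟩
    rintro F' ⟨hF', ε, z, hz⟩
    obtain ⟨t, ht, -, hdt⟩ := hz.exists_germ
    exact LocalForm.eq_of_density_eq hF' hF ht hs hdt hds
  · intro β hβ ε z z' hz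
    refine ⟨fun hz' => hz.exists_rotation hβ hz', ?_⟩
    rintro ⟨a, ha, haz⟩
    exact hz.const_mul (norm_ne_zero_iff.mp (by rw [ha]; exact one_ne_zero))
      (LocalForm.coeff_power_const_mul β ha) haz
  · intro c hc ε z z' hz
    refine ⟨fun hz' => hz.exists_scaling hc hz', ?_⟩
    rintro ⟨p, hp, hpz⟩
    exact hz.const_mul hp (LocalForm.coeff_cylinder_const_mul c hp) hpz
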